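/- **Setting.** Let $M$ be a smooth $3$-manifold (Hausdorff, second countable, not necessarily compact), and let $(J,\theta)$ be a smooth strictly pseudoconvex pseudohermitian structure on $M$: $\theta$ is a contact form, $J$ is a complex structure on $\xi=\ker\theta$, and $d\theta(\cdot,J\cdot)$ is a Hermitian metric on $(\xi,J)$. All further pseudohermitian structures $(J',\theta')$ below are required to have the same contact structure $\ker\theta'=\xi$ with the same coorientation. For such a structure $(J',\theta')$ take near any point a unitary admissible coframe $\theta',\theta^1,\theta^{\bar 1}$, i.e. a complex $1$-form $\theta^1$, with conjugate $\theta^{\bar1}$, that vanishes on the Reeb field, is complex linear on $(\xi,J')$, and satisfies $d\theta'=i\,\theta^1\wedge\theta^{\bar 1}$; let $T',Z_1,Z_{\bar 1}$ be the dual frame, with $T'$ the Reeb field. The Tanaka-Webster connection form $\omega_1{}^1$ (with values in $i\mathbb R$) and the torsion coefficient $A_{11}$ are determined by $$d\theta^1=\theta^1\wedge\omega_1{}^1+\theta'\wedge\tau^1,\qquad \tau^1=\overline{A_{11}}\,\theta^{\bar 1},$$ and the Webster curvature $W$ by $d\omega_1{}^1\equiv W\,\theta^1\wedge\theta^{\bar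 1}$ modulo $\theta'$. The torsion tensor is $A_{J',\theta'}=A_{11}\,Z_{\bar 1}\otimes\theta^1+\overline{A_{11}}\,Z_1\otimes\theta^{\bar 1}$. The torsion flow is $$\partial_tJ_t=2A_{J_t,\theta_t},\qquad \partial_t\theta_t=-2W\theta_t .\qquad(1)$$ **Proposition.** Suppose that the integral first Chern class $c_1(\xi,J)\in H^2(M;\mathbb Z)$ vanishes. Then there is a smooth global frame $T,U,V$ of $TM$, with $T$ the Reeb field of $\theta$ and $U,V$ sections of $\xi$, whose dual coframe $\theta,\alpha,\beta$ is a basis of $T^*M$ with $d\theta=\alpha\wedge\beta$, such that the following holds. For smooth real functions $a,b,c$ on $M$ with $b,c>0$ put $$\theta_b=b^2\theta,\quad \alpha_b=b\alpha-2V(b)\theta,\quad \beta_b=b\beta+2U(b)\theta,\quad U_b=\tfrac1bU,\quad V_b=\tfrac1bV,$$ $$J_{abc}U_b=aU_b+cV_b,\qquad J_{abc}V_b=-\tfrac{1+a^2}{c}U_b-aV_b,$$ $$\theta^1_{abc}=\sqrt{2c(a^2+1)}\Bigl(\tfrac{-i}{2(a-i)}\alpha_b+\tfrac{i}{2c}\beta_b\Bigr).$$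 1. For all such $a,b,c$, $(J_{abc},\theta_b)$ is a strictly pseudoconvex pseudohermitian structure with contact structure $\xi$ and the coorientation of $\theta$, and $\theta_b,\theta^1_{abc},\overline{\theta^1_{abc}}$ is a global unitary admissible coframe for it, which has a Tanaka-Webster connection form. Write $A_{11}^{abc}$ for its torsion coefficient in this coframe and $W^{abc}$ for its Webster curvature. 2. Every strictly pseudoconvex pseudohermitian structure $(J',\theta')$ with contact structure $\xi$ and the coorientation of $\theta$, in particular $(J,\theta)$, equals $(J_{abc},\theta_b)$ for exactly one triple of smooth functions $a,b,c$ with $b,c>0$. 3. Let $I\subset\mathbb R$ be an interval with more than one point. Smooth families $(J_t,\theta_t)_{t\in I}$ of such structures are exactly the families $(J_{a_tb_tc_t},\theta_{b_t})_{t\in I}$ with $a,b,c$ smooth on $I\times M$ and $b,c>0$, and such a family solves the torsion flow (1) on $I$ if and only if on $I\times M$ $$\begin{aligned}\dot a&=2\bigl(\operatorname{Re}A_{11}^{abc}+a\operatorname{Im}A_{11}^{abc}\bigr),\\ \dot c&=-2\Bigl(\operatorname{Re}(A_{11}^{abc})\,\frac{-2ac}{a^2+1}+\operatorname{Im}(A_{11}^{abc})\,\frac{(1-a^2)c}{a^2+1}\Bigr),\\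 \frac{d}{dt}(b^2)&=-2W^{abc}b^2 .\end{aligned}$$ -/

import Mathlib

open scoped Manifold ContDiff Topology ComplexConjugate
open Bundle Set

noncomputable section

namespace TorsionFlow

universe u

/-- The model space of a `3`-manifold. -/
abbrev E3 : Type := EuclideanSpace ℝ (Fin 3)

variable {M : Type u} [TopologicalSpace M] [ChartedSpace E3 M]

/-! ### Vector fields and differential forms of degree one -/

/-- Vector fields on `M` (not necessarily smooth). -/
abbrev VField (M : Type u) [TopologicalSpace M] [ChartedSpace E3 M] : Type u :=
  ∀ x : M, TangentSpace (𝓡 3) x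

/-- `F`-valued `1`-forms on `M` (not necessarily smooth). For `F = ℂ` these are the complex
`1`-forms: complex linear forms on `TM ⊗ ℂ` are the same as real linear maps `TM → ℂ`. -/
abbrev OneForm (M : Type u) [TopologicalSpace M] [ChartedSpace E3 M]
    (F : Type) [NormedAddCommGroup F] [NormedSpace ℝ F] : Type u :=
  ∀ x : M, TangentSpace (𝓡 3) x →L[ℝ] F

/-- The vector field `X` is smooth on the set `O`. -/
def SmoothVField [IsManifold (𝓡 3) ∞ M] (X : VField M) (O : Set M) : Prop :=
  ContMDiffOn (𝓡 3) ((𝓡 3).prod 𝓘(ℝ, E3)) ∞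
    (fun x => TotalSpace.mk' E3 (E := (TangentSpace (𝓡 3) : M → Type)) x (X x)) O

/-- The `1`-form `η` is smooth on the set `O`. -/
def SmoothForm [IsManifold (𝓡 3) ∞ M] {F : Type} [NormedAddCommGroup F] [NormedSpace ℝ F]
    (η : OneForm M F) (O : Set M) : Prop :=
  ContMDiffOn (𝓡 3) ((𝓡 3).prod 𝓘(ℝ, E3 →L[ℝ] F)) ∞
    (fun x => TotalSpace.mk' (E3 →L[ℝ] F)
      (E := fun x : M => TangentSpace (𝓡 3) x →L[ℝ] Bundle.Trivial M F x) x (η x)) O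

/-- The expression of the `1`-form `η` in the preferred chart at `x₀`, i.e. its pullback under
the inverse of that chart. -/
def inChart {F : Type} [NormedAddCommGroup F] [NormedSpace ℝ F]
    (η : OneForm M F) (x₀ : M) (y : E3) : E3 →L[ℝ] F :=
  (η ((extChartAt (𝓡 3) x₀).symm y)).comp
    (mfderiv 𝓘(ℝ, E3) (𝓡 3) (extChartAt (𝓡 3) x₀).symm y)

/-- The exterior derivative `dη` at `x` of a `1`-form `η`, evaluated on two tangent vectors. It is
computed in the preferred chart at `x`, with the convention
`dη (X, Y) = X (η Y) - Y (η X) - η [X, Y]`. -/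
def dForm {F : Type} [NormedAddCommGroup F] [NormedSpace ℝ F]
    (η : OneForm M F) (x : M) (v w : TangentSpace (𝓡 3) x) : F :=
  extDeriv (fun y => ContinuousAlternatingMap.ofSubsingleton ℝ E3 F (0 : Fin 1) (inChart η x y))
    (extChartAt (𝓡 3) x x)
    ![mfderiv (𝓡 3) 𝓘(ℝ, E3) (extChartAt (𝓡 3) x) x v,
      mfderiv (𝓡 3) 𝓘(ℝ, E3) (extChartAt (𝓡 3) x) x w]

/-- The derivative `X(f)` of a real function along a vector field. -/
def dirDeriv (f : M → ℝ) (X : VField M) (x : M) : ℝ :=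
  mfderiv (𝓡 3) 𝓘(ℝ, ℝ) f x (X x)

/-! ### Pseudohermitian structures -/

/-- A field of linear subspaces of the tangent spaces of `M`. -/
abbrev PlaneField (M : Type u) [TopologicalSpace M] [ChartedSpace E3 M] : Type u :=
  ∀ x : M, Submodule ℝ (TangentSpace (𝓡 3) x)

/-- Fields of endomorphisms of the plane field `ξ`. -/
abbrev PlaneEndo (ξ : PlaneField M) : Type u := ∀ x : M, ξ x →ₗ[ℝ] ξ x

/-- `(J, θ)` is a smooth strictly pseudoconvex pseudohermitian structure with underlying contact
structure `ξ`: the smooth `1`-form `θ` is a contact form (`θ ∧ dθ ≠ 0`) with kernel `ξ`, and `J` is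
a smooth complex structure on `ξ` for which `dθ(·, J ·)` is a Hermitian metric on `(ξ, J)`.
The integrability condition of a CR structure is empty in dimension three, as `T^{1,0}` has
complex rank one. -/
structure IsPseudohermitian [IsManifold (𝓡 3) ∞ M]
    (ξ : PlaneField M) (J : PlaneEndo ξ) (θ : OneForm M ℝ) : Prop where
  smooth_form : SmoothForm θ univ
  ker_eq : ∀ x v, v ∈ ξ x ↔ θ x v = 0
  contact : ∀ x, ∃ u v w : TangentSpace (𝓡 3) x,
    θ x u * dForm θ x v w + θ x v * dForm θ x w u + θ x w * dForm θ x u v ≠ 0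
  smooth_J : ∀ (O : Set M) (X : ∀ x, ξ x), IsOpen O →
    SmoothVField (fun x => (X x : TangentSpace (𝓡 3) x)) O →
    SmoothVField (fun x => (J x (X x) : TangentSpace (𝓡 3) x)) O
  J_sq : ∀ x (v : ξ x), J x (J x v) = -v
  compatible : ∀ x (v w : ξ x), dForm θ x (J x v) (J x w) = dForm θ x v w
  pos : ∀ x (v : ξ x), v ≠ 0 → 0 < dForm θ x v (J x v)

/-- `v` is the value at `x` of the Reeb vector field of the contact form `θ`. -/
def IsReebAt (θ : OneForm M ℝ) (x : M) (v : TangentSpace (𝓡 3) x) : Prop :=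
  θ x v = 1 ∧ ∀ w, dForm θ x v w = 0

/-- `θ₁` is (on the open set `O`) the `(1,0)`-form of a unitary admissible coframe
`θ, θ¹, conj θ¹` of `(J, θ)`: it is smooth, vanishes on the Reeb field, is complex linear on
`(ξ, J)`, and `dθ = i θ¹ ∧ conj θ¹`. -/
structure IsAdmissibleCoframe [IsManifold (𝓡 3) ∞ M]
    (ξ : PlaneField M) (J : PlaneEndo ξ) (θ : OneForm M ℝ)
    (O : Set M) (θ₁ : OneForm M ℂ) : Prop where
  smooth : SmoothForm θ₁ O
  reeb : ∀ x ∈ O, ∀ v, IsReebAt θ x v → θ₁ x v = 0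
  complex_linear : ∀ x ∈ O, ∀ v : ξ x, θ₁ x (J x v) = Complex.I * θ₁ x v
  levi : ∀ x ∈ O, ∀ v w, ((dForm θ x v w : ℝ) : ℂ) =
    Complex.I * (θ₁ x v * conj (θ₁ x w) - θ₁ x w * conj (θ₁ x v))

/-- `φ = ω₁¹` is the connection form of the Tanaka-Webster connection and `A = A₁₁` the coefficient
of its torsion, with respect to the unitary admissible coframe `θ₁ = θ¹` on `O`:
`dθ¹ = θ¹ ∧ ω₁¹ + θ ∧ τ¹`, `ω₁¹ + conj ω₁¹ = 0`, and `τ₁ ∧ θ¹ = 0`; the last equation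
means `τ₁ = A₁₁ θ¹`, and `τ¹` is the conjugate of `τ₁`. -/
structure IsTanakaWebster [IsManifold (𝓡 3) ∞ M] (θ : OneForm M ℝ) (O : Set M)
    (θ₁ φ : OneForm M ℂ) (A : M → ℂ) : Prop where
  smooth : SmoothForm φ O
  structure_eq : ∀ x ∈ O, ∀ v w, dForm θ₁ x v w =
    (θ₁ x v * φ x w - θ₁ x w * φ x v) +
    ((θ x v : ℂ) * conj (A x * θ₁ x w) - (θ x w : ℂ) * conj (A x * θ₁ x v))
  skew : ∀ x ∈ O, ∀ v, φ x v + conj (φ x v) = 0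

/-- `B` is the value at `x` of the torsion tensor
`A_{J,θ} = A¹_{1̄} Z₁ ⊗ conj θ¹ + conj (A¹_{1̄} Z₁ ⊗ conj θ¹)`, where `A¹_{1̄} = conj A₁₁`, computed
in some unitary admissible coframe near `x`; a vector of `ξ` is determined by its
`θ¹`-component. -/
def IsTorsionAt [IsManifold (𝓡 3) ∞ M] (ξ : PlaneField M) (J : PlaneEndo ξ)
    (θ : OneForm M ℝ) (x : M) (B : ξ x →ₗ[ℝ] ξ x) : Prop :=
  ∃ (O : Set M) (θ₁ φ : OneForm M ℂ) (A : M → ℂ), IsOpen O ∧ x ∈ O ∧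
    IsAdmissibleCoframe ξ J θ O θ₁ ∧ IsTanakaWebster θ O θ₁ φ A ∧
    ∀ v : ξ x, θ₁ x (B v) = conj (A x) * conj (θ₁ x v)

/-- `W` is the Webster curvature at `x`, computed in some unitary admissible coframe near `x`:
`dω₁¹ = W θ¹ ∧ conj θ¹` modulo `θ`. -/
def IsWebsterAt [IsManifold (𝓡 3) ∞ M] (ξ : PlaneField M) (J : PlaneEndo ξ)
    (θ : OneForm M ℝ) (x : M) (W : ℝ) : Prop :=
  ∃ (O : Set M) (θ₁ φ : OneForm M ℂ) (A : M → ℂ), IsOpen O ∧ x ∈ O ∧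
    IsAdmissibleCoframe ξ J θ O θ₁ ∧ IsTanakaWebster θ O θ₁ φ A ∧
    ∀ v w : ξ x, dForm φ x v w =
      (W : ℂ) * (θ₁ x v * conj (θ₁ x w) - θ₁ x w * conj (θ₁ x v))

/-- The torsion tensor `A_{J,θ}` of a pseudohermitian structure, an endomorphism of `ξ`. -/
def torsionTensor [IsManifold (𝓡 3) ∞ M] (ξ : PlaneField M) (J : PlaneEndo ξ)
    (θ : OneForm M ℝ) : PlaneEndo ξ :=
  fun x => Classical.epsilon (IsTorsionAt ξ J θ x)

/-- The Webster curvature of a pseudohermitian structure. -/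
def websterCurvature [IsManifold (𝓡 3) ∞ M] (ξ : PlaneField M) (J : PlaneEndo ξ)
    (θ : OneForm M ℝ) : M → ℝ :=
  fun x => Classical.epsilon (IsWebsterAt ξ J θ x)

/-- The torsion coefficient `A₁₁` with respect to a global unitary admissible coframe `θ₁`. -/
def torsionCoeff [IsManifold (𝓡 3) ∞ M] (θ : OneForm M ℝ) (θ₁ : OneForm M ℂ) : M → ℂ :=
  fun x => Classical.epsilon
    (fun z => ∃ (φ : OneForm M ℂ) (A : M → ℂ), IsTanakaWebster θ univ θ₁ φ A ∧ A x = z)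

/-! ### The torsion flow -/

/-- `(t, x) ↦ f t x` is smooth on `I × M`. -/
def SmoothFunFamily (I : Set ℝ) (f : ℝ → M → ℝ) : Prop :=
  ContMDiffOn (𝓘(ℝ, ℝ).prod (𝓡 3)) 𝓘(ℝ, ℝ) ∞ (fun p : ℝ × M => f p.1 p.2) (I ×ˢ univ)

/-- `(J_t, θ_t)`, `t ∈ I`, is a smooth family of pseudohermitian structures on the fixed contact
structure `ξ`: each member is one, and the components of `θ_t` and `J_t` are smooth
on `I × M`. -/
structure IsSmoothFamily [IsManifold (𝓡 3) ∞ M] (ξ : PlaneField M) (I : Set ℝ)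
    (J : ℝ → PlaneEndo ξ) (θ : ℝ → OneForm M ℝ) : Prop where
  pseudohermitian : ∀ t ∈ I, IsPseudohermitian ξ (J t) (θ t)
  smooth_form : ∀ X : VField M, SmoothVField X univ → SmoothFunFamily I (fun t x => θ t x (X x))
  smooth_J : ∀ (X : ∀ x, ξ x) (η : OneForm M ℝ),
    SmoothVField (fun x => (X x : TangentSpace (𝓡 3) x)) univ → SmoothForm η univ →
    SmoothFunFamily I (fun t x => η x (J t x (X x)))

/-- The `1`-form `θ'` defines the same coorientation as `θ`. -/
def SameCoorientation (θ θ' : OneForm M ℝ) : Prop := ∀ x v, 0 < θ x v → 0 < θ' x v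

/-- The torsion flow `∂ₜ J = 2 A_{J,θ}`, `∂ₜ θ = -2 W θ` on the time interval `I` (with one-sided
derivatives at end points of `I` that belong to `I`). -/
def IsTorsionFlow [IsManifold (𝓡 3) ∞ M] (ξ : PlaneField M) (I : Set ℝ)
    (J : ℝ → PlaneEndo ξ) (θ : ℝ → OneForm M ℝ) : Prop :=
  ∀ t ∈ I, ∀ x : M,
    (∀ v : ξ x, HasDerivWithinAt (fun s => (J s x v : TangentSpace (𝓡 3) x))
      ((2 : ℝ) • (torsionTensor ξ (J t) (θ t) x v : TangentSpace (𝓡 3) x)) I t) ∧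
    (∀ v : TangentSpace (𝓡 3) x, HasDerivWithinAt (fun s => θ s x v)
      (-2 * websterCurvature ξ (J t) (θ t) x * θ t x v) I t)

/-! ### Global frames and the structures `J_{abc}` -/

/-- The data of a global frame `T, U, V` of `TM`, with `U, V` in `ξ`, and of the two forms
`α, β` which together with a contact form constitute the dual coframe. -/
structure Frame (ξ : PlaneField M) where
  T : VField M
  U : ∀ x : M, ξ x
  V : ∀ x : M, ξ x
  α : OneForm M ℝ
  β : OneForm M ℝ

/-- `T` is the Reeb field of `θ`, all members of the frame are smooth, `θ, α, β` is a basis of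
`T^*M` at each point and the dual basis of `T, U, V`, and `dθ = α ∧ β`, i.e. `U, V` is a symplectic
frame of `(ξ, dθ)`. -/
structure IsSymplecticFrame [IsManifold (𝓡 3) ∞ M] {ξ : PlaneField M}
    (θ : OneForm M ℝ) (F : Frame ξ) : Prop where
  smooth_T : SmoothVField F.T univ
  smooth_U : SmoothVField (fun x => (F.U x : TangentSpace (𝓡 3) x)) univ
  smooth_V : SmoothVField (fun x => (F.V x : TangentSpace (𝓡 3) x)) univ
  smooth_α : SmoothForm F.α univ
  smooth_β : SmoothForm F.β univ
  reeb : ∀ x, IsReebAt θ x (F.T x)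
  basis : ∀ x, LinearIndependent ℝ ![θ x, F.α x, F.β x] ∧
    Submodule.span ℝ (Set.range ![θ x, F.α x, F.β x]) = ⊤
  θ_dual : ∀ x, θ x (F.T x) = 1 ∧ θ x (F.U x) = 0 ∧ θ x (F.V x) = 0
  α_dual : ∀ x, F.α x (F.T x) = 0 ∧ F.α x (F.U x) = 1 ∧ F.α x (F.V x) = 0
  β_dual : ∀ x, F.β x (F.T x) = 0 ∧ F.β x (F.U x) = 0 ∧ F.β x (F.V x) = 1
  d_theta : ∀ x v w, dForm θ x v w = F.α x v * F.β x w - F.α x w * F.β x v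

/-- `θ_b = b² θ`. -/
def thetaB (θ : OneForm M ℝ) (b : M → ℝ) : OneForm M ℝ := fun x => (b x ^ 2) • θ x

/-- The frame `T_b, U_b, V_b, α_b, β_b` obtained by deforming `θ` to `θ_b = b² θ`. -/
def Frame.deform {ξ : PlaneField M} (F : Frame ξ) (θ : OneForm M ℝ) (b : M → ℝ) : Frame ξ where
  T := fun x => (1 / b x ^ 2) • F.T x
    + (2 * dirDeriv b (fun y => (F.V y : TangentSpace (𝓡 3) y)) x / b x ^ 3) •
        (F.U x : TangentSpace (𝓡 3) x)
    - (2 * dirDeriv b (fun y => (F.U y : TangentSpace (𝓡 3) y)) x / b x ^ 3) •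
        (F.V x : TangentSpace (𝓡 3) x)
  U := fun x => (1 / b x) • F.U x
  V := fun x => (1 / b x) • F.V x
  α := fun x => b x • F.α x
    - (2 * dirDeriv b (fun y => (F.V y : TangentSpace (𝓡 3) y)) x) • θ x
  β := fun x => b x • F.β x
    + (2 * dirDeriv b (fun y => (F.U y : TangentSpace (𝓡 3) y)) x) • θ x

/-- The complex structure on `ξ` with `J U = a U + c V`, `J V = -(1 + a²)/c U - a V` in the
frame `F`. -/
def Frame.complexStructure {ξ : PlaneField M} (F : Frame ξ) (a c : M → ℝ) : PlaneEndo ξ :=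
  fun x =>
    ((F.α x : TangentSpace (𝓡 3) x →ₗ[ℝ] ℝ).comp (ξ x).subtype).smulRight
      (a x • F.U x + c x • F.V x) +
    ((F.β x : TangentSpace (𝓡 3) x →ₗ[ℝ] ℝ).comp (ξ x).subtype).smulRight
      (-((1 + a x ^ 2) / c x) • F.U x - a x • F.V x)

/-- The form `θ¹ = √(2c(a²+1)) ( -i/(2(a-i)) α + i/(2c) β )` in the frame `F`. -/
def Frame.complexCoframe {ξ : PlaneField M} (F : Frame ξ) (a c : M → ℝ) : OneForm M ℂ :=
  fun x => ((Real.sqrt (2 * c x * (a x ^ 2 + 1)) : ℝ) : ℂ) •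
    ((-Complex.I / (2 * ((a x : ℂ) - Complex.I))) • Complex.ofRealCLM.comp (F.α x) +
      (Complex.I / (2 * (c x : ℂ))) • Complex.ofRealCLM.comp (F.β x))

/-- The complex structure `J_{abc}`: it is given by `J U_b = a U_b + c V_b`,
`J V_b = -(1 + a²)/c U_b - a V_b`. -/
def Jabc {ξ : PlaneField M} (F : Frame ξ) (θ : OneForm M ℝ) (a b c : M → ℝ) : PlaneEndo ξ :=
  (F.deform θ b).complexStructure a c

/-- The form `θ¹_{abc}`. -/
def theta1abc {ξ : PlaneField M} (F : Frame ξ) (θ : OneForm M ℝ) (a b c : M → ℝ) : OneForm M ℂ :=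
  (F.deform θ b).complexCoframe a c

/-- `A₁₁^{abc}`: the coefficient `A₁₁` of the torsion of `(J_{abc}, θ_b)` with respect to the
coframe `θ_b, θ¹_{abc}`. -/
def A11abc [IsManifold (𝓡 3) ∞ M] {ξ : PlaneField M} (F : Frame ξ) (θ : OneForm M ℝ)
    (a b c : M → ℝ) : M → ℂ :=
  torsionCoeff (thetaB θ b) (theta1abc F θ a b c)

/-- `W^{abc}`: the Webster curvature of `(J_{abc}, θ_b)`. -/
def Wabc [IsManifold (𝓡 3) ∞ M] {ξ : PlaneField M} (F : Frame ξ) (θ : OneForm M ℝ)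
    (a b c : M → ℝ) : M → ℝ :=
  websterCurvature ξ (Jabc F θ a b c) (thetaB θ b)

/-- The system of partial differential equations for the functions `a, b, c` on `I × M`. -/
def SolvesSystem [IsManifold (𝓡 3) ∞ M] {ξ : PlaneField M} (F : Frame ξ) (θ : OneForm M ℝ)
    (I : Set ℝ) (a b c : ℝ → M → ℝ) : Prop :=
  ∀ t ∈ I, ∀ x : M,
    HasDerivWithinAt (fun s => a s x)
      (2 * ((A11abc F θ (a t) (b t) (c t) x).re
        + a t x * (A11abc F θ (a t) (b t) (c t) x).im)) I t ∧
    HasDerivWithinAt (fun s => c s x)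
      (-2 * ((A11abc F θ (a t) (b t) (c t) x).re * (-2 * a t x * c t x / (a t x ^ 2 + 1))
        + (A11abc F θ (a t) (b t) (c t) x).im
          * ((1 - a t x ^ 2) * c t x / (a t x ^ 2 + 1)))) I t ∧
    HasDerivWithinAt (fun s => b s x ^ 2)
      (-2 * Wabc F θ (a t) (b t) (c t) x * b t x ^ 2) I t

/-! ### The first Chern class -/

/-- Scalar multiplication of `ℂ` on the complex line bundle `(ξ, J)`. -/
def cmul {ξ : PlaneField M} (J : PlaneEndo ξ) (x : M) (z : ℂ) (v : ξ x) : ξ x :=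
  z.re • v + z.im • J x v

/-- An open cover of a space. -/
structure OpenCover (M : Type u) [TopologicalSpace M] where
  ι : Type u
  U : ι → Set M
  isOpen : ∀ i, IsOpen (U i)
  covers : ∀ x, ∃ i, x ∈ U i

/-- A Čech `2`-cocycle of an open cover with values in the constant sheaf `ℤ`: locally constant
functions `z i j k` on `U i ∩ U j ∩ U k` with `δ z = 0`. -/
structure CechTwoCocycle {M : Type u} [TopologicalSpace M] (𝒰 : OpenCover M) where
  z : 𝒰.ι → 𝒰.ι → 𝒰.ι → M → ℤ
  locallyConstant : ∀ i j k, ContinuousOn (z i j k) (𝒰.U i ∩ 𝒰.U j ∩ 𝒰.U k)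
  cocycle : ∀ i j k l, ∀ x ∈ 𝒰.U i ∩ 𝒰.U j ∩ 𝒰.U k ∩ 𝒰.U l,
    z j k l x - z i k l x + z i j l x - z i j k x = 0

/-- The class of the cocycle in `H²(M; ℤ)`, the direct limit over all open covers of the Čech
cohomology groups of the covers, is zero: on some refinement of the cover the cocycle is the
coboundary of a `1`-cochain `m` with values in the constant sheaf `ℤ`. -/
def CechTwoCocycle.ClassEqZero {M : Type u} [TopologicalSpace M] {𝒰 : OpenCover M}
    (C : CechTwoCocycle 𝒰) : Prop :=
  ∃ (𝒱 : OpenCover M) (r : 𝒱.ι → 𝒰.ι) (m : 𝒱.ι → 𝒱.ι → M → ℤ),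
    (∀ i, 𝒱.U i ⊆ 𝒰.U (r i)) ∧
    (∀ i j, ContinuousOn (m i j) (𝒱.U i ∩ 𝒱.U j)) ∧
    ∀ i j k, ∀ x ∈ 𝒱.U i ∩ 𝒱.U j ∩ 𝒱.U k,
      C.z (r i) (r j) (r k) x = m j k x - m i k x + m i j x

/-- `C` represents the integral first Chern class of the complex line bundle `(ξ, J)`, i.e. (up to
the usual choice of sign) the image of the class of the bundle under the connecting homomorphism
of the exponential sequence `0 → ℤ → C^∞(·, ℂ) → C^∞(·, ℂ^*) → 0`: there are smooth non-vanishing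
local sections `s i` of `ξ` on the `U i`, and logarithms `f i j` of their
transition functions, such that `C = δ f`. -/
def RepresentsChernClass [IsManifold (𝓡 3) ∞ M] {ξ : PlaneField M} (J : PlaneEndo ξ)
    {𝒰 : OpenCover M} (C : CechTwoCocycle 𝒰) : Prop :=
  ∃ (s : 𝒰.ι → ∀ x : M, ξ x) (f : 𝒰.ι → 𝒰.ι → M → ℂ),
    (∀ i, SmoothVField (fun x => (s i x : TangentSpace (𝓡 3) x)) (𝒰.U i)) ∧
    (∀ i, ∀ x ∈ 𝒰.U i, s i x ≠ 0) ∧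
    (∀ i j, ContMDiffOn (𝓡 3) 𝓘(ℝ, ℂ) ∞ (f i j) (𝒰.U i ∩ 𝒰.U j)) ∧
    (∀ i j, ∀ x ∈ 𝒰.U i ∩ 𝒰.U j,
      s j x = cmul J x (Complex.exp (2 * Real.pi * Complex.I * f i j x)) (s i x)) ∧
    ∀ i j k, ∀ x ∈ 𝒰.U i ∩ 𝒰.U j ∩ 𝒰.U k,
      (C.z i j k x : ℂ) = f j k x - f i k x + f i j x

/-- The integral first Chern class `c₁(ξ, J)` vanishes. -/
def FirstChernClassEqZero [IsManifold (𝓡 3) ∞ M] {ξ : PlaneField M} (J : PlaneEndo ξ) : Prop :=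
  ∃ (𝒰 : OpenCover M) (C : CechTwoCocycle 𝒰), RepresentsChernClass J C ∧ C.ClassEqZero

end TorsionFlow

end

noncomputable section

namespace TorsionFlow

universe u

variable {M : Type u} [TopologicalSpace M] [ChartedSpace E3 M]

/-! Everything rests on a nowhere vanishing section of `ξ`. If the first Chern class is zero,
subtracting an integer cochain from the logarithms of the transition functions leaves a smooth
additive cocycle. A partition of unity splits it, and the exponentials of the splitting rescale the
local sections to a global section `S` (`exists_global_section`). Then `U = S` and `V = JS / dθ(S,
JS)` form a symplectic frame of `ξ`, with dual forms obtained by contracting `dθ`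
(`exists_isContactFrame`).

In such a frame a structure amounts to three functions. A form with the same kernel and
coorientation is `b²θ`. A matrix with square `-1` is determined by its first column `(a, c)`, and
positivity of the Levi form means `c > 0` (`classification`). The corrections in `α_b`, `β_b`
restore `dθ_b = α_b ∧ β_b` (`deform`) and vanish on `ξ`, so `J_{abc}` does not depend on `b`
(`deform_complexStructure`).

For a unitary `θ¹ = Pα + Qβ` the Tanaka-Webster structure equation is a linear system with an
explicit solution (`exists_isTanakaWebster`). Its one compatibility condition, that `φ(T)` be
imaginary, is a consequence of `d(dθ) = 0` (`trace_bracket`). The torsion tensor is independent of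
the coframe because `2 J ∘ A` is the Lie derivative of `J` along `T` (`torsion_apply`), so it can be
computed as a matrix from `A₁₁` in the coframe `θ¹_{abc}` (`coframe_torsionEndo`). This matrix
anticommutes with `J`; hence its second column is the variation forced by `J² = -1`, and `∂ₜJ = 2A`
reduces to the equations for `a` and `c`. The curvature is the same function in the flow and in the
system, so the last equation is `∂ₜθ = -2Wθ` evaluated on `T` (`isTorsionFlow_iff`). -/

lemma two_le_infty : (2 : WithTop ℕ∞) ≤ ∞ :=
  WithTop.coe_le_coe.2 (le_top : (2 : ℕ∞) ≤ ⊤)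

/-! ### Pointwise smoothness of vector fields and one-forms -/

/-- The vector field `X` is smooth at the point `x`. -/
def SmoothVFieldAt [IsManifold (𝓡 3) ∞ M] (X : VField M) (x : M) : Prop :=
  ContMDiffAt (𝓡 3) ((𝓡 3).prod 𝓘(ℝ, E3)) ∞
    (fun x => TotalSpace.mk' E3 (E := (TangentSpace (𝓡 3) : M → Type)) x (X x)) x

/-- The `1`-form `η` is smooth at the point `x`. -/
def SmoothFormAt [IsManifold (𝓡 3) ∞ M] {F : Type} [NormedAddCommGroup F] [NormedSpace ℝ F]
    (η : OneForm M F) (x : M) : Prop :=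
  ContMDiffAt (𝓡 3) ((𝓡 3).prod 𝓘(ℝ, E3 →L[ℝ] F)) ∞
    (fun x => TotalSpace.mk' (E3 →L[ℝ] F)
      (E := fun x : M => TangentSpace (𝓡 3) x →L[ℝ] Bundle.Trivial M F x) x (η x)) x

section

variable [IsManifold (𝓡 3) ∞ M] {F : Type} [NormedAddCommGroup F] [NormedSpace ℝ F]

lemma SmoothVField.at {X : VField M} {O : Set M} (h : SmoothVField X O) (hO : IsOpen O) {x : M}
    (hx : x ∈ O) : SmoothVFieldAt X x :=
  (h x hx).contMDiffAt (hO.mem_nhds hx)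

lemma SmoothForm.at {η : OneForm M F} {O : Set M} (h : SmoothForm η O) (hO : IsOpen O) {x : M}
    (hx : x ∈ O) : SmoothFormAt η x :=
  (h x hx).contMDiffAt (hO.mem_nhds hx)

lemma SmoothVFieldAt.smoothVField {X : VField M} {O : Set M} (h : ∀ x ∈ O, SmoothVFieldAt X x) :
    SmoothVField X O :=
  fun x hx => (h x hx).contMDiffWithinAt

lemma SmoothFormAt.smoothForm {η : OneForm M F} {O : Set M} (h : ∀ x ∈ O, SmoothFormAt η x) :
    SmoothForm η O :=
  fun x hx => (h x hx).contMDiffWithinAt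

lemma smoothVField_univ_iff {X : VField M} : SmoothVField X univ ↔ ∀ x, SmoothVFieldAt X x :=
  ⟨fun h _ => h.at isOpen_univ (mem_univ _), fun h => SmoothVFieldAt.smoothVField fun x _ => h x⟩

lemma smoothForm_univ_iff {η : OneForm M F} : SmoothForm η univ ↔ ∀ x, SmoothFormAt η x :=
  ⟨fun h _ => h.at isOpen_univ (mem_univ _), fun h => SmoothFormAt.smoothForm fun x _ => h x⟩

/-- The form `η` near `x`, read in the trivialization of the tangent bundle at `x`. -/
def formInTrivialization (η : OneForm M F) (x y : M) : E3 →L[ℝ] F :=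
  (η y).comp ((trivializationAt E3 (TangentSpace (𝓡 3)) x).symmL ℝ y)

lemma smoothFormAt_iff {η : OneForm M F} {x : M} :
    SmoothFormAt η x ↔ ContMDiffAt (𝓡 3) 𝓘(ℝ, E3 →L[ℝ] F) ∞ (formInTrivialization η x) x := by
  unfold SmoothFormAt
  rw [contMDiffAt_hom_bundle]
  simp only [ContinuousLinearMap.inCoordinates]
  constructor
  · rintro ⟨-, h⟩
    refine h.congr_of_eventuallyEq ?_
    filter_upwards with y
    ext v
    simp [formInTrivialization]
  · intro h
    refine ⟨contMDiffAt_id, h.congr_of_eventuallyEq ?_⟩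
    filter_upwards with y
    ext v
    simp [formInTrivialization]

lemma SmoothFormAt.apply {η : OneForm M F} {X : VField M} {x : M} (hη : SmoothFormAt η x)
    (hX : SmoothVFieldAt X x) : ContMDiffAt (𝓡 3) 𝓘(ℝ, F) ∞ (fun y => η y (X y)) x := by
  have := ContMDiffAt.clm_bundle_apply (𝕜 := ℝ) (F₂ := F) (E₂ := Bundle.Trivial M F) hη hX
  rw [contMDiffAt_totalSpace] at this
  exact this.2

omit [IsManifold (𝓡 3) ∞ M] in
-- A linear map on `E3` is the sum of its values on a basis times the coordinate functionals, so
-- smoothness of these values is enough.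
lemma contMDiffAt_clm_of_apply {f : M → E3 →L[ℝ] F} {x : M}
    (h : ∀ v, ContMDiffAt (𝓡 3) 𝓘(ℝ, F) ∞ (fun y => f y v) x) :
    ContMDiffAt (𝓡 3) 𝓘(ℝ, E3 →L[ℝ] F) ∞ f x := by
  have key : f = fun y => ∑ i : Fin 3, ContinuousLinearMap.smulRightL ℝ E3 F
      (EuclideanSpace.proj i) (f y (EuclideanSpace.basisFun (Fin 3) ℝ i)) := by
    funext y
    ext v
    conv_lhs => rw [← (EuclideanSpace.basisFun (Fin 3) ℝ).sum_repr v]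
    simp
  rw [key]
  refine ContMDiffAt.sum fun i _ => ?_
  exact (ContinuousLinearMap.contMDiff _).contMDiffAt.comp x (h _)

lemma smoothVFieldAt_symmL {x y : M}
    (hy : y ∈ (trivializationAt E3 (TangentSpace (𝓡 3) : M → Type) x).baseSet) (v : E3) :
    SmoothVFieldAt (fun y => (trivializationAt E3 (TangentSpace (𝓡 3)) x).symmL ℝ y v) y := by
  have h1 := (trivializationAt E3 (TangentSpace (𝓡 3)) x).contMDiffAt_symmL (n := ∞)
    (IB := 𝓡 3) hy
  have h2 : ContMDiffAt (𝓡 3) ((𝓡 3).prod 𝓘(ℝ, E3)) ∞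
      (fun y : M => TotalSpace.mk' E3 (E := Bundle.Trivial M E3) y v) y := by
    rw [contMDiffAt_totalSpace]
    exact ⟨contMDiffAt_id, contMDiffAt_const⟩
  exact ContMDiffAt.clm_bundle_apply (E₁ := Bundle.Trivial M E3) h1 h2

lemma eventually_smoothVFieldAt_symmL (x : M) (v : E3) : ∀ᶠ y in 𝓝 x,
    SmoothVFieldAt (fun y => (trivializationAt E3 (TangentSpace (𝓡 3)) x).symmL ℝ y v) y := by
  filter_upwards [(trivializationAt E3 (TangentSpace (𝓡 3) : M → Type) x).open_baseSet.mem_nhds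
    (mem_baseSet_trivializationAt E3 (TangentSpace (𝓡 3)) x)] with y hy
  exact smoothVFieldAt_symmL hy v

/-- Constant vectors in a trivialization suffice as test fields. They are smooth on a whole
neighbourhood, and this is needed when the values of `η` involve derivatives of the test field, as
in `contractRight`. -/
lemma smoothFormAt_of_eventually_apply {η : OneForm M F} {x : M}
    (h : ∀ X : VField M, (∀ᶠ y in 𝓝 x, SmoothVFieldAt X y) →
      ContMDiffAt (𝓡 3) 𝓘(ℝ, F) ∞ (fun y => η y (X y)) x) : SmoothFormAt η x :=
  smoothFormAt_iff.2 (contMDiffAt_clm_of_apply fun v => h _ (eventually_smoothVFieldAt_symmL x v))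

lemma smoothFormAt_of_apply {η : OneForm M F} {x : M}
    (h : ∀ X : VField M, SmoothVFieldAt X x →
      ContMDiffAt (𝓡 3) 𝓘(ℝ, F) ∞ (fun y => η y (X y)) x) : SmoothFormAt η x :=
  smoothFormAt_of_eventually_apply fun X hX => h X hX.self_of_nhds

lemma exists_smoothVFieldAt {x : M} (v : TangentSpace (𝓡 3) x) :
    ∃ X : VField M, X x = v ∧ SmoothVFieldAt X x :=
  ⟨FiberBundle.extend E3 v, by simp, FiberBundle.contMDiffAt_extend (𝓡 3) E3 v⟩

lemma SmoothVFieldAt.add {X Y : VField M} {x : M} (hX : SmoothVFieldAt X x)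
    (hY : SmoothVFieldAt Y x) : SmoothVFieldAt (fun y => X y + Y y) x :=
  ContMDiffAt.add_section hX hY

lemma SmoothVFieldAt.sub {X Y : VField M} {x : M} (hX : SmoothVFieldAt X x)
    (hY : SmoothVFieldAt Y x) : SmoothVFieldAt (fun y => X y - Y y) x :=
  ContMDiffAt.sub_section hX hY

lemma SmoothVFieldAt.smul {f : M → ℝ} {X : VField M} {x : M}
    (hf : ContMDiffAt (𝓡 3) 𝓘(ℝ, ℝ) ∞ f x) (hX : SmoothVFieldAt X x) :
    SmoothVFieldAt (fun y => f y • X y) x :=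
  ContMDiffAt.smul_section hf hX

lemma SmoothVFieldAt.congr {X Y : VField M} {x : M} (hX : SmoothVFieldAt X x)
    (h : ∀ᶠ y in 𝓝 x, Y y = X y) : SmoothVFieldAt Y x :=
  ContMDiffAt.congr_of_eventuallyEq hX (h.mono fun y hy => by simp [hy])

lemma SmoothVFieldAt.bracket {X Y : VField M} {x : M} (hX : SmoothVFieldAt X x)
    (hY : SmoothVFieldAt Y x) : SmoothVFieldAt (VectorField.mlieBracket (𝓡 3) X Y) x := by
  -- The bracket costs one derivative, which is harmless because `∞ + 1 = ∞`.
  have : IsManifold (𝓡 3) (((⊤ : ℕ∞) : WithTop ℕ∞) + 1) M := by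
    have : (((⊤ : ℕ∞) : WithTop ℕ∞) + 1) = ∞ := rfl
    rw [this]; infer_instance
  have : IsManifold (𝓡 3) (minSmoothness ℝ 2) M :=
    IsManifold.of_le (n := ∞) (by simpa using two_le_infty)
  exact ContMDiffAt.mlieBracket_vectorField (m := ⊤) (n := ⊤) hX hY (by simp)

/-! ### Differentials of functions and Cartan's formula -/

/-- The differential of a function, as a `1`-form. -/
def differential (f : M → F) : OneForm M F := fun x => mfderiv (𝓡 3) 𝓘(ℝ, F) f x

lemma smoothFormAt_differential {f : M → F} {x : M}
    (hf : ContMDiffAt (𝓡 3) 𝓘(ℝ, F) ∞ f x) : SmoothFormAt (differential f) x := by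
  refine smoothFormAt_of_apply fun X hX => ?_
  have h := hf.mfderiv_const (m := ∞) (by rfl)
  have := ContMDiffAt.clm_apply_of_inCoordinates (b₁ := id) (b₂ := f) (F₂ := F)
    (E₂ := TangentSpace 𝓘(ℝ, F)) (IB₂ := 𝓘(ℝ, F)) h hX hf
  rw [contMDiffAt_totalSpace] at this
  simpa using! this.2

omit [IsManifold (𝓡 3) ∞ M]

lemma differential_eq_fderiv {f : M → F} {x : M}
    (hf : MDifferentiableAt (𝓡 3) 𝓘(ℝ, F) f x) (v : TangentSpace (𝓡 3) x) :
    differential f x v =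
      fderiv ℝ (fun y => f ((extChartAt (𝓡 3) x).symm y)) (extChartAt (𝓡 3) x x) v := by
  have h : mfderiv (𝓡 3) 𝓘(ℝ, F) f x = fderivWithin ℝ
      (writtenInExtChartAt (𝓡 3) 𝓘(ℝ, F) x f) (range (𝓡 3)) (extChartAt (𝓡 3) x x) := by
    rw [mfderiv]; exact if_pos hf
  rw [ModelWithCorners.range_eq_univ, fderivWithin_univ] at h
  exact congrArg (fun L : E3 →L[ℝ] F => L v) h

lemma differential_congr {f g : M → F} {x : M} (h : f =ᶠ[𝓝 x] g) :
    differential f x = differential g x :=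
  h.mfderiv_eq

lemma differential_const (c : F) (x : M) : differential (fun _ : M => c) x = 0 :=
  mfderiv_const

lemma differential_add {f g : M → F} {x : M} (hf : MDifferentiableAt (𝓡 3) 𝓘(ℝ, F) f x)
    (hg : MDifferentiableAt (𝓡 3) 𝓘(ℝ, F) g x) :
    differential (fun y => f y + g y) x = differential f x + differential g x :=
  mfderiv_add hf hg

lemma differential_clm_comp {G : Type} [NormedAddCommGroup G] [NormedSpace ℝ G] (L : F →L[ℝ] G)
    {f : M → F} {x : M} (hf : MDifferentiableAt (𝓡 3) 𝓘(ℝ, F) f x) (v : TangentSpace (𝓡 3) x) :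
    differential (fun y => L (f y)) x v = L (differential f x v) := by
  have h := mfderiv_comp (I' := 𝓘(ℝ, F)) (I'' := 𝓘(ℝ, G)) x
    (g := L) L.differentiableAt.mdifferentiableAt hf
  have h2 : mfderiv 𝓘(ℝ, F) 𝓘(ℝ, G) L (f x) = L := by
    rw [mfderiv_eq_fderiv, L.fderiv]
  rw [h2] at h
  exact congrArg (fun A : E3 →L[ℝ] G => A v) h

lemma differential_mul {A : Type} [NormedCommRing A] [NormedAlgebra ℝ A] {f g : M → A} {x : M}
    (hf : MDifferentiableAt (𝓡 3) 𝓘(ℝ, A) f x) (hg : MDifferentiableAt (𝓡 3) 𝓘(ℝ, A) g x)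
    (v : TangentSpace (𝓡 3) x) :
    differential (fun y => f y * g y) x v =
      f x * differential g x v + g x * differential f x v := by
  have h := (hf.hasMFDerivAt.mul hg.hasMFDerivAt).mfderiv
  exact congrArg (fun L : E3 →L[ℝ] A => L v) h

end

/-- By the product rule the two derivatives contribute `η(DW V) - η(DV W)`, which is `η` of the
bracket; what remains is the alternated derivative of `η`. -/
lemma extDeriv_ofSubsingleton_apply {E F : Type*} [NormedAddCommGroup E] [NormedSpace ℝ E]
    [NormedAddCommGroup F] [NormedSpace ℝ F] {η : E → E →L[ℝ] F} {V W : E → E} {p : E}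
    (hη : DifferentiableAt ℝ η p) (hV : DifferentiableAt ℝ V p) (hW : DifferentiableAt ℝ W p) :
    extDeriv (fun y => ContinuousAlternatingMap.ofSubsingleton ℝ E F (0 : Fin 1) (η y)) p
      ![V p, W p] = fderiv ℝ (fun y => η y (W y)) p (V p) - fderiv ℝ (fun y => η y (V y)) p (W p) -
        η p (VectorField.lieBracket ℝ V W p) := by
  let L : (E →L[ℝ] F) →L[ℝ] E [⋀^Fin 1]→L[ℝ] F :=
    (ContinuousAlternatingMap.ofSubsingletonLIE (𝕜 := ℝ) (E := E) (F := F)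
      (0 : Fin 1)).toContinuousLinearEquiv.toContinuousLinearMap
  have hd : HasFDerivAt
      (fun y => ContinuousAlternatingMap.ofSubsingleton ℝ E F (0 : Fin 1) (η y))
      (L.comp (fderiv ℝ η p)) p :=
    L.hasFDerivAt.comp p hη.hasFDerivAt
  have hc : ∀ u v : E, fderiv ℝ (fun y => η y u) p v = fderiv ℝ η p v u := fun u v => by
    rw [fderiv_clm_apply hη (differentiableAt_const u)]
    simp
  rw [extDeriv_apply hd.differentiableAt, fderiv_clm_apply hη hW, fderiv_clm_apply hη hV]
  simp [hc, Fin.sum_univ_two, Fin.removeNth, VectorField.lieBracket]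
  abel

section

variable [IsManifold (𝓡 3) ∞ M] {F : Type} [NormedAddCommGroup F] [NormedSpace ℝ F]

/-- The derivative of the inverse chart is the inverse of the trivialization of the tangent bundle.
This carries smoothness from the bundle to the chart in which `dForm` is computed. -/
lemma inChart_eventuallyEq (η : OneForm M F) (x : M) :
    inChart η x =ᶠ[𝓝 (extChartAt (𝓡 3) x x)]
      fun y => formInTrivialization η x ((extChartAt (𝓡 3) x).symm y) := by
  filter_upwards [extChartAt_target_mem_nhds (I := 𝓡 3) x] with y hy
  have h1 : (extChartAt (𝓡 3) x).symm y ∈ (chartAt E3 x).source := by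
    simpa using (extChartAt (𝓡 3) x).map_target hy
  have h2 := TangentBundle.symmL_trivializationAt (I := 𝓡 3) (𝕜 := ℝ) h1
  rw [(extChartAt (𝓡 3) x).right_inv hy, ModelWithCorners.range_eq_univ, mfderivWithin_univ] at h2
  rw [inChart, formInTrivialization, h2]

lemma SmoothFormAt.contDiffAt_inChart {η : OneForm M F} {x : M} (hη : SmoothFormAt η x) :
    ContDiffAt ℝ ∞ (inChart η x) (extChartAt (𝓡 3) x x) := by
  refine ContDiffAt.congr_of_eventuallyEq ?_ (inChart_eventuallyEq η x)
  rw [← contMDiffAt_iff_contDiffAt]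
  have h1 : ContMDiffAt 𝓘(ℝ, E3) (𝓡 3) ∞ (extChartAt (𝓡 3) x).symm (extChartAt (𝓡 3) x x) :=
    (contMDiffOn_extChartAt_symm x).contMDiffAt (extChartAt_target_mem_nhds x)
  refine ContMDiffAt.comp (I' := 𝓡 3) (extChartAt (𝓡 3) x x)
    (g := formInTrivialization η x) ?_ h1
  rw [extChartAt_to_inv]
  exact smoothFormAt_iff.1 hη

/-- `dForm` uses a chart that changes with the point; Cartan's formula removes this dependence and
makes `dForm` computable in a frame. Form, fields and bracket are all pulled back to the chart,
where the formula is the product rule. -/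
lemma dForm_apply {η : OneForm M F} {X Y : VField M} {x : M} (hη : SmoothFormAt η x)
    (hX : SmoothVFieldAt X x) (hY : SmoothVFieldAt Y x) :
    dForm η x (X x) (Y x) = differential (fun y => η y (Y y)) x (X x) -
      differential (fun y => η y (X y)) x (Y x) -
      η x (VectorField.mlieBracket (𝓡 3) X Y x) := by
  have : IsManifold (𝓡 3) 1 M := IsManifold.of_le (n := ∞) (by simp)
  have : IsManifold (𝓡 3) 2 M := IsManifold.of_le (n := ∞) (two_le_infty)
  set φ := extChartAt (𝓡 3) x with hφ
  let P : VField M → E3 → E3 := fun X => VectorField.mpullback 𝓘(ℝ, E3) (𝓡 3) φ.symm X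
  have hdiff : ∀ {X : VField M}, SmoothVFieldAt X x → DifferentiableAt ℝ (P X) (φ x) := by
    intro X hX
    have h := MDifferentiableWithinAt.differentiableWithinAt_mpullbackWithin_vectorField
      (I := 𝓡 3) (s := univ) (x := x) (V := X)
      (hX.mdifferentiableAt (by simp)).mdifferentiableWithinAt
    rw [ModelWithCorners.range_eq_univ] at h
    rw [preimage_univ, univ_inter] at h
    have h' : DifferentiableWithinAt ℝ (P X) univ (φ x) := by
      rw [VectorField.mpullbackWithin_univ] at h
      exact h
    exact differentiableWithinAt_univ.1 h'
  -- The derivative of the inverse chart is invertible, so pulling back both the form and the field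
  -- preserves their pairing.
  have heval : ∀ {y}, y ∈ φ.target → ∀ X : VField M,
      inChart η x y (P X y) = η (φ.symm y) (X (φ.symm y)) := by
    intro y hy X
    have h := isInvertible_mfderivWithin_extChartAt_symm (I := 𝓡 3) hy
    rw [ModelWithCorners.range_eq_univ, mfderivWithin_univ] at h
    show η (φ.symm y) (mfderiv 𝓘(ℝ, E3) (𝓡 3) φ.symm y
      ((mfderiv 𝓘(ℝ, E3) (𝓡 3) φ.symm y).inverse (X (φ.symm y)))) = _
    congr 1
    exact h.self_apply_inverse _
  -- At its own centre the chart has derivative the identity, so vectors at `x` need no transport.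
  have hmf : mfderiv (𝓡 3) 𝓘(ℝ, E3) φ x = ContinuousLinearMap.id ℝ _ := mfderiv_extChartAt_self
  have hid : ∀ L : E3 →L[ℝ] E3, L = ContinuousLinearMap.id ℝ E3 → ∀ v, L.inverse v = v := by
    rintro _ rfl v
    rw [ContinuousLinearMap.inverse_id]
    rfl
  have hS : (mfderiv 𝓘(ℝ, E3) (𝓡 3) φ.symm (φ x) : E3 →L[ℝ] E3) = ContinuousLinearMap.id ℝ E3 := by
    have h := mfderivWithin_range_extChartAt_symm (I := 𝓡 3) (x := x)
    rw [ModelWithCorners.range_eq_univ, mfderivWithin_univ] at h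
    exact h
  have hsymm : φ.symm (φ x) = x := extChartAt_to_inv x
  have hP0 : ∀ X : VField M, P X (φ x) = X x := by
    intro X
    exact (hid _ hS _).trans (congrArg (fun y => X y : M → E3) hsymm)
  have hinv : ∀ w : E3, inChart η x (φ x) w = η x w := by
    intro w
    show ((fun y => η y : M → E3 →L[ℝ] F) (φ.symm (φ x)))
      ((mfderiv 𝓘(ℝ, E3) (𝓡 3) φ.symm (φ x) : E3 →L[ℝ] E3) w) =
        (fun y => η y : M → E3 →L[ℝ] F) x w
    rw [hS, hsymm]
    rfl
  have hbr : VectorField.mlieBracket (𝓡 3) X Y x = VectorField.lieBracket ℝ (P X) (P Y) (φ x) := by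
    rw [← VectorField.mlieBracketWithin_univ, VectorField.mlieBracketWithin_apply]
    rw [ModelWithCorners.range_eq_univ, VectorField.mpullbackWithin_univ,
      VectorField.mpullbackWithin_univ, preimage_univ, univ_inter]
    refine (hid _ hmf _).trans ?_
    exact congrFun (VectorField.lieBracketWithin_univ (V := P X) (W := P Y)) (φ x)
  have hη' : DifferentiableAt ℝ (inChart η x) (φ x) :=
    hη.contDiffAt_inChart.differentiableAt (by simp)
  have hval : ∀ Z : VField M, SmoothVFieldAt Z x → ∀ v : E3,
      fderiv ℝ (fun y => inChart η x y (P Z y)) (φ x) v = differential (fun y => η y (Z y)) x v := by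
    intro Z hZ v
    refine Eq.trans ?_ (differential_eq_fderiv ((hη.apply hZ).mdifferentiableAt (by simp)) v).symm
    refine congrArg (fun L : E3 →L[ℝ] F => L v) ?_
    refine Filter.EventuallyEq.fderiv_eq ?_
    filter_upwards [extChartAt_target_mem_nhds (I := 𝓡 3) x] with y hy using heval hy Z
  have hmain := extDeriv_ofSubsingleton_apply hη' (hdiff hX) (hdiff hY)
  rw [hval Y hY, hval X hX, hinv, hP0, hP0] at hmain
  rw [hbr]
  refine Eq.trans ?_ hmain
  rw [dForm, hmf]
  rfl

end

section

variable {G : Type} [NormedAddCommGroup G] [NormedSpace ℝ G]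

lemma dForm_swap (η : OneForm M G) (x : M) (v w : TangentSpace (𝓡 3) x) :
    dForm η x v w = -dForm η x w v := by
  unfold dForm
  generalize extDeriv (𝕜 := ℝ) (E := E3) (F := G) (n := 1) _ _ = A
  have := A.toAlternatingMap.map_swap ![mfderiv (𝓡 3) 𝓘(ℝ, E3) (extChartAt (𝓡 3) x) x w,
      mfderiv (𝓡 3) 𝓘(ℝ, E3) (extChartAt (𝓡 3) x) x v] (i := 0) (j := 1) (by simp)
  refine Eq.trans ?_ this
  show A _ = A _
  congr 1
  funext i
  fin_cases i <;> rfl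

lemma dForm_add_left (η : OneForm M G) (x : M) (v v' w : TangentSpace (𝓡 3) x) :
    dForm η x (v + v') w = dForm η x v w + dForm η x v' w := by
  unfold dForm
  rw [map_add]
  generalize extDeriv (𝕜 := ℝ) (E := E3) (F := G) (n := 1) _ _ = A
  exact A.vecCons_add _ _ _

lemma dForm_smul_left (η : OneForm M G) (x : M) (r : ℝ) (v w : TangentSpace (𝓡 3) x) :
    dForm η x (r • v) w = r • dForm η x v w := by
  unfold dForm
  rw [map_smul]
  generalize extDeriv (𝕜 := ℝ) (E := E3) (F := G) (n := 1) _ _ = A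
  exact A.vecCons_smul _ _ _

lemma dForm_add_right (η : OneForm M G) (x : M) (v w w' : TangentSpace (𝓡 3) x) :
    dForm η x v (w + w') = dForm η x v w + dForm η x v w' := by
  rw [dForm_swap, dForm_add_left, dForm_swap η x v, dForm_swap η x v]
  abel

lemma dForm_smul_right (η : OneForm M G) (x : M) (r : ℝ) (v w : TangentSpace (𝓡 3) x) :
    dForm η x v (r • w) = r • dForm η x v w := by
  rw [dForm_swap, dForm_smul_left, dForm_swap η x v, smul_neg]

lemma dForm_self (η : OneForm M G) (x : M) (v : TangentSpace (𝓡 3) x) : dForm η x v v = 0 := by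
  have h := dForm_swap η x v v
  have h2 : (2 : ℝ) • dForm η x v v = 0 := by
    rw [two_smul]
    nth_rw 2 [h]
    exact add_neg_cancel _
  simpa using h2

end

/-! ### Contact frames and their structure functions -/

/-- The contact form `θ` is smooth with kernel `ξ`, and `F` is a symplectic frame for it. -/
structure IsContactFrame [IsManifold (𝓡 3) ∞ M] {ξ : PlaneField M} (θ : OneForm M ℝ)
    (F : Frame ξ) : Prop extends IsSymplecticFrame θ F where
  smooth_θ : SmoothForm θ univ
  ker_eq : ∀ x v, v ∈ ξ x ↔ θ x v = 0

namespace IsContactFrame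

variable [IsManifold (𝓡 3) ∞ M] {ξ : PlaneField M} {θ : OneForm M ℝ} {F : Frame ξ}
  (hF : IsContactFrame θ F)

include hF

lemma smoothAt_T (x : M) : SmoothVFieldAt F.T x := smoothVField_univ_iff.1 hF.smooth_T x

lemma smoothAt_U (x : M) : SmoothVFieldAt (fun x => (F.U x : TangentSpace (𝓡 3) x)) x :=
  smoothVField_univ_iff.1 hF.smooth_U x

lemma smoothAt_V (x : M) : SmoothVFieldAt (fun x => (F.V x : TangentSpace (𝓡 3) x)) x :=
  smoothVField_univ_iff.1 hF.smooth_V x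

lemma smoothAt_θ (x : M) : SmoothFormAt θ x := smoothForm_univ_iff.1 hF.smooth_θ x

lemma smoothAt_α (x : M) : SmoothFormAt F.α x := smoothForm_univ_iff.1 hF.smooth_α x

lemma smoothAt_β (x : M) : SmoothFormAt F.β x := smoothForm_univ_iff.1 hF.smooth_β x

lemma eq_of_coframe_eq {x : M} {v w : TangentSpace (𝓡 3) x} (h₀ : θ x v = θ x w)
    (h₁ : F.α x v = F.α x w) (h₂ : F.β x v = F.β x w) : v = w := by
  have key : ∀ η : TangentSpace (𝓡 3) x →L[ℝ] ℝ, η (v - w) = 0 := by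
    intro η
    have hη : η ∈ Submodule.span ℝ (Set.range ![θ x, F.α x, F.β x]) := by
      rw [(hF.basis x).2]; trivial
    induction hη using Submodule.span_induction with
    | mem η h =>
      obtain ⟨i, rfl⟩ := h
      fin_cases i <;> simp [h₀, h₁, h₂]
    | zero => simp
    | add η η' _ _ h h' =>
      rw [_root_.add_apply, h, h', add_zero]
    | smul r η _ h =>
      rw [_root_.smul_apply, h, smul_zero]
  -- The tangent space is `E3` by definition, so the functional `⟨v - w, ·⟩` is available as a test.
  let d : E3 := (v - w : TangentSpace (𝓡 3) x)
  have h : inner ℝ d d = 0 := key (innerSL ℝ d)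
  have hd : d = 0 := inner_self_eq_zero.1 h
  exact sub_eq_zero.1 hd

lemma decomp {x : M} (v : TangentSpace (𝓡 3) x) :
    v = θ x v • F.T x + F.α x v • (F.U x : TangentSpace (𝓡 3) x) +
      F.β x v • (F.V x : TangentSpace (𝓡 3) x) := by
  obtain ⟨hθT, hθU, hθV⟩ := hF.θ_dual x
  obtain ⟨hαT, hαU, hαV⟩ := hF.α_dual x
  obtain ⟨hβT, hβU, hβV⟩ := hF.β_dual x
  apply hF.eq_of_coframe_eq <;> simp [*]

lemma decomp_plane {x : M} (v : ξ x) : v = F.α x v • F.U x + F.β x v • F.V x := by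
  have h := hF.decomp (v : TangentSpace (𝓡 3) x)
  rw [(hF.ker_eq x v).1 v.2, zero_smul, zero_add] at h
  exact Subtype.ext h

/-- When `θ(X)` and `θ(Y)` are constant, the derivative terms of Cartan's formula vanish and `θ[X,
Y] = -dθ(X, Y)`. -/
lemma θ_bracket {X Y : VField M} {x : M} {p q : ℝ} (hX : SmoothVFieldAt X x)
    (hY : SmoothVFieldAt Y x) (hp : ∀ y, θ y (X y) = p) (hq : ∀ y, θ y (Y y) = q) :
    θ x (VectorField.mlieBracket (𝓡 3) X Y x) =
      F.α x (Y x) * F.β x (X x) - F.α x (X x) * F.β x (Y x) := by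
  have h := dForm_apply (hF.smoothAt_θ x) hX hY
  simp only [hp, hq, differential_const, _root_.zero_apply] at h
  rw [hF.d_theta] at h
  linarith

/-- The identity `d (dθ) = 0`, as a relation between the structure functions of the frame. -/
lemma trace_bracket (x : M) :
    F.α x (VectorField.mlieBracket (𝓡 3) F.T (fun y => (F.U y : TangentSpace (𝓡 3) y)) x) +
      F.β x (VectorField.mlieBracket (𝓡 3) F.T (fun y => (F.V y : TangentSpace (𝓡 3) y)) x) = 0 := by
  set U : VField M := fun y => (F.U y : TangentSpace (𝓡 3) y)
  set V : VField M := fun y => (F.V y : TangentSpace (𝓡 3) y)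
  have hT := fun y => hF.smoothAt_T y
  have hU : ∀ y, SmoothVFieldAt U y := fun y => hF.smoothAt_U y
  have hV : ∀ y, SmoothVFieldAt V y := fun y => hF.smoothAt_V y
  have hθT : ∀ y, θ y (F.T y) = 1 := fun y => (hF.θ_dual y).1
  have hθU : ∀ y, θ y (U y) = 0 := fun y => (hF.θ_dual y).2.1
  have hθV : ∀ y, θ y (V y) = 0 := fun y => (hF.θ_dual y).2.2
  have hαT : ∀ y, F.α y (F.T y) = 0 := fun y => (hF.α_dual y).1
  have hαU : ∀ y, F.α y (U y) = 1 := fun y => (hF.α_dual y).2.1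
  have hαV : ∀ y, F.α y (V y) = 0 := fun y => (hF.α_dual y).2.2
  have hβT : ∀ y, F.β y (F.T y) = 0 := fun y => (hF.β_dual y).1
  have hβU : ∀ y, F.β y (U y) = 0 := fun y => (hF.β_dual y).2.1
  have hβV : ∀ y, F.β y (V y) = 1 := fun y => (hF.β_dual y).2.2
  have hTU : ∀ y, θ y (VectorField.mlieBracket (𝓡 3) F.T U y) = 0 := fun y => by
    rw [hF.θ_bracket (hT y) (hU y) hθT hθU, hαT, hβT]; ring
  have hTV : ∀ y, θ y (VectorField.mlieBracket (𝓡 3) F.T V y) = 0 := fun y => by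
    rw [hF.θ_bracket (hT y) (hV y) hθT hθV, hαT, hβT]; ring
  have hUV : ∀ y, θ y (VectorField.mlieBracket (𝓡 3) U V y) = -1 := fun y => by
    rw [hF.θ_bracket (hU y) (hV y) hθU hθV, hαU, hβU, hβV, hαV]; ring
  have : IsManifold (𝓡 3) (minSmoothness ℝ 3) M :=
    IsManifold.of_le (n := ∞) (by simpa using WithTop.coe_le_coe.2 (le_top : (3 : ℕ∞) ≤ ⊤))
  have hle : minSmoothness ℝ 2 ≤ ∞ := by simpa using two_le_infty
  -- Apply `θ` to the Jacobi identity `[T,[U,V]] = [[T,U],V] + [U,[T,V]]`. The inner brackets have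
  -- constant `θ`-component, so `θ_bracket` applies once more; the left side vanishes because `α(T)
  -- = β(T) = 0`.
  have J := VectorField.leibniz_identity_mlieBracket_apply (I := 𝓡 3) (x := x)
    ((hT x).of_le hle) ((hU x).of_le hle) ((hV x).of_le hle)
  have J' := congrArg (θ x) J
  rw [map_add, hF.θ_bracket (hT x) ((hU x).bracket (hV x)) hθT hUV,
    hF.θ_bracket ((hT x).bracket (hU x)) (hV x) hTU hθV,
    hF.θ_bracket (hU x) ((hT x).bracket (hV x)) hθU hTV, hαT, hβT, hαV, hβV, hαU, hβU] at J'
  linarith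

end IsContactFrame

/-! ### Existence of the Tanaka-Webster connection -/

/-- The complex `1`-form `P α + Q β`. -/
def Frame.combination {ξ : PlaneField M} (F : Frame ξ) (P Q : M → ℂ) : OneForm M ℂ :=
  fun x => P x • Complex.ofRealCLM.comp (F.α x) + Q x • Complex.ofRealCLM.comp (F.β x)

lemma Frame.combination_apply {ξ : PlaneField M} (F : Frame ξ) (P Q : M → ℂ) (x : M)
    (v : TangentSpace (𝓡 3) x) :
    F.combination P Q x v = P x * (F.α x v : ℂ) + Q x * (F.β x v : ℂ) := by
  simp [Frame.combination]

lemma contMDiffAt_ofReal {f : M → ℝ} {x : M} (hf : ContMDiffAt (𝓡 3) 𝓘(ℝ, ℝ) ∞ f x) :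
    ContMDiffAt (𝓡 3) 𝓘(ℝ, ℂ) ∞ (fun y => (f y : ℂ)) x :=
  Complex.ofRealCLM.contMDiff.contMDiffAt.comp x hf

lemma contMDiffAt_re {f : M → ℂ} {x : M} (hf : ContMDiffAt (𝓡 3) 𝓘(ℝ, ℂ) ∞ f x) :
    ContMDiffAt (𝓡 3) 𝓘(ℝ, ℝ) ∞ (fun y => (f y).re) x :=
  Complex.reCLM.contMDiff.contMDiffAt.comp x hf

lemma contMDiffAt_im {f : M → ℂ} {x : M} (hf : ContMDiffAt (𝓡 3) 𝓘(ℝ, ℂ) ∞ f x) :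
    ContMDiffAt (𝓡 3) 𝓘(ℝ, ℝ) ∞ (fun y => (f y).im) x :=
  Complex.imCLM.contMDiff.contMDiffAt.comp x hf

lemma contMDiffAt_conj {f : M → ℂ} {x : M} (hf : ContMDiffAt (𝓡 3) 𝓘(ℝ, ℂ) ∞ f x) :
    ContMDiffAt (𝓡 3) 𝓘(ℝ, ℂ) ∞ (fun y => conj (f y)) x :=
  (Complex.conjCLE : ℂ →L[ℝ] ℂ).contMDiff.contMDiffAt.comp x hf

lemma ContMDiffAt.complex_mul {f g : M → ℂ} {x : M} (hf : ContMDiffAt (𝓡 3) 𝓘(ℝ, ℂ) ∞ f x)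
    (hg : ContMDiffAt (𝓡 3) 𝓘(ℝ, ℂ) ∞ g x) :
    ContMDiffAt (𝓡 3) 𝓘(ℝ, ℂ) ∞ (fun y => f y * g y) x :=
  ((ContinuousLinearMap.mul ℝ ℂ).contMDiff.contMDiffAt.comp x hf).clm_apply hg

namespace IsContactFrame

variable [IsManifold (𝓡 3) ∞ M] {ξ : PlaneField M} {θ : OneForm M ℝ} {F : Frame ξ}
  (hF : IsContactFrame θ F)

include hF

lemma smoothAt_combination {P Q : M → ℂ} {x : M} (hP : ContMDiffAt (𝓡 3) 𝓘(ℝ, ℂ) ∞ P x)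
    (hQ : ContMDiffAt (𝓡 3) 𝓘(ℝ, ℂ) ∞ Q x) : SmoothFormAt (F.combination P Q) x := by
  refine smoothFormAt_of_apply fun X hX => ?_
  simp only [Frame.combination_apply]
  exact (ContMDiffAt.complex_mul hP (contMDiffAt_ofReal ((hF.smoothAt_α x).apply hX))).add
    (ContMDiffAt.complex_mul hQ (contMDiffAt_ofReal ((hF.smoothAt_β x).apply hX)))

lemma dForm_eq {G : Type} [NormedAddCommGroup G] [NormedSpace ℝ G] (η : OneForm M G) (x : M)
    (v w : TangentSpace (𝓡 3) x) :
    dForm η x v w =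
      (θ x v * F.α x w - θ x w * F.α x v) • dForm η x (F.T x) (F.U x) +
      (θ x v * F.β x w - θ x w * F.β x v) • dForm η x (F.T x) (F.V x) +
      (F.α x v * F.β x w - F.α x w * F.β x v) • dForm η x (F.U x) (F.V x) := by
  conv_lhs => rw [hF.decomp v, hF.decomp w]
  simp only [dForm_add_left, dForm_add_right, dForm_smul_left, dForm_smul_right, dForm_self]
  rw [dForm_swap η x (F.V x) (F.U x), dForm_swap η x (F.V x) (F.T x),
    dForm_swap η x (F.U x) (F.T x)]
  module

/-- The determinant condition says `i θ¹ ∧ conj θ¹ = α ∧ β`, that is, the coframe is unitary. It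
also makes the linear system for the connection and the torsion invertible, with smooth solution. -/
lemma exists_isTanakaWebster {P Q : M → ℂ} (hP : ∀ x, ContMDiffAt (𝓡 3) 𝓘(ℝ, ℂ) ∞ P x)
    (hQ : ∀ x, ContMDiffAt (𝓡 3) 𝓘(ℝ, ℂ) ∞ Q x)
    (hPQ : ∀ x, (P x).re * (Q x).im - (P x).im * (Q x).re = 1 / 2) :
    ∃ (φ : OneForm M ℂ) (A : M → ℂ), IsTanakaWebster θ univ (F.combination P Q) φ A := by
  set U : VField M := fun y => (F.U y : TangentSpace (𝓡 3) y) with hUdef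
  set V : VField M := fun y => (F.V y : TangentSpace (𝓡 3) y) with hVdef
  have hT := fun y => hF.smoothAt_T y
  have hU : ∀ y, SmoothVFieldAt U y := fun y => hF.smoothAt_U y
  have hV : ∀ y, SmoothVFieldAt V y := fun y => hF.smoothAt_V y
  set θ₁ := F.combination P Q with hθ₁
  have hs : ∀ x, SmoothFormAt θ₁ x := fun x => hF.smoothAt_combination (hP x) (hQ x)
  have hT1 : ∀ y, θ₁ y (F.T y) = 0 := fun y => by
    simp [hθ₁, F.combination_apply, (hF.α_dual y).1, (hF.β_dual y).1]
  have hU1 : ∀ y, θ₁ y (U y) = P y := fun y => by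
    simp [hθ₁, hUdef, F.combination_apply, (hF.α_dual y).2.1, (hF.β_dual y).2.1]
  have hV1 : ∀ y, θ₁ y (V y) = Q y := fun y => by
    simp [hθ₁, hVdef, F.combination_apply, (hF.α_dual y).2.2, (hF.β_dual y).2.2]
  let D₁ : M → ℂ := fun x => dForm θ₁ x (F.T x) (U x)
  let D₂ : M → ℂ := fun x => dForm θ₁ x (F.T x) (V x)
  let D₃ : M → ℂ := fun x => dForm θ₁ x (U x) (V x)
  have e₁ : ∀ x, D₁ x = differential P x (F.T x) -
      θ₁ x (VectorField.mlieBracket (𝓡 3) F.T U x) := fun x => by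
    have h := dForm_apply (hs x) (hT x) (hU x)
    simp only [hT1, hU1, differential_const, _root_.zero_apply, sub_zero] at h
    exact h
  have e₂ : ∀ x, D₂ x = differential Q x (F.T x) -
      θ₁ x (VectorField.mlieBracket (𝓡 3) F.T V x) := fun x => by
    have h := dForm_apply (hs x) (hT x) (hV x)
    simp only [hT1, hV1, differential_const, _root_.zero_apply, sub_zero] at h
    exact h
  have e₃ : ∀ x, D₃ x = differential Q x (U x) - differential P x (V x) -
      θ₁ x (VectorField.mlieBracket (𝓡 3) U V x) := fun x => by
    have h := dForm_apply (hs x) (hU x) (hV x)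
    simp only [hU1, hV1] at h
    exact h
  have s₁ : ∀ x, ContMDiffAt (𝓡 3) 𝓘(ℝ, ℂ) ∞ D₁ x := fun x => by
    rw [show D₁ = _ from funext e₁]
    exact ((smoothFormAt_differential (hP x)).apply (hT x)).sub
      ((hs x).apply ((hT x).bracket (hU x)))
  have s₂ : ∀ x, ContMDiffAt (𝓡 3) 𝓘(ℝ, ℂ) ∞ D₂ x := fun x => by
    rw [show D₂ = _ from funext e₂]
    exact ((smoothFormAt_differential (hQ x)).apply (hT x)).sub
      ((hs x).apply ((hT x).bracket (hV x)))
  have s₃ : ∀ x, ContMDiffAt (𝓡 3) 𝓘(ℝ, ℂ) ∞ D₃ x := fun x => by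
    rw [show D₃ = _ from funext e₃]
    exact (((smoothFormAt_differential (hQ x)).apply (hU x)).sub
      ((smoothFormAt_differential (hP x)).apply (hV x))).sub
      ((hs x).apply ((hU x).bracket (hV x)))
  -- This makes `φ(T)` imaginary. Differentiating the constant determinant along `T` removes the
  -- derivative terms, and the bracket terms combine to the determinant times the trace in
  -- `trace_bracket`.
  have htr : ∀ x, (D₁ x * conj (Q x) - D₂ x * conj (P x)).im = 0 := by
    intro x
    have hPr := (contMDiffAt_re (hP x)).mdifferentiableAt (by simp)
    have hPi := (contMDiffAt_im (hP x)).mdifferentiableAt (by simp)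
    have hQr := (contMDiffAt_re (hQ x)).mdifferentiableAt (by simp)
    have hQi := (contMDiffAt_im (hQ x)).mdifferentiableAt (by simp)
    have h0 : differential (fun y => (P y).re * (Q y).im) x (F.T x) =
        differential (fun y => (P y).im * (Q y).re) x (F.T x) := by
      have : (fun y => (P y).re * (Q y).im) = fun y => 1 / 2 + (P y).im * (Q y).re := by
        funext y
        linarith [hPQ y]
      rw [this, differential_add mdifferentiableAt_const (g := fun y => (P y).im * (Q y).re) (hPi.mul hQr),
        differential_const]
      simp
    rw [differential_mul hPr hQi, differential_mul hPi hQr] at h0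
    have re' : ∀ f : M → ℂ, ContMDiffAt (𝓡 3) 𝓘(ℝ, ℂ) ∞ f x →
        differential (fun y => (f y).re) x (F.T x) = (differential f x (F.T x)).re := fun f hf =>
      differential_clm_comp Complex.reCLM (hf.mdifferentiableAt (by simp)) _
    have im' : ∀ f : M → ℂ, ContMDiffAt (𝓡 3) 𝓘(ℝ, ℂ) ∞ f x →
        differential (fun y => (f y).im) x (F.T x) = (differential f x (F.T x)).im := fun f hf =>
      differential_clm_comp Complex.imCLM (hf.mdifferentiableAt (by simp)) _
    rw [re' P (hP x), im' P (hP x), re' Q (hQ x), im' Q (hQ x)] at h0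
    have h1 := hF.trace_bracket x
    rw [e₁, e₂, hθ₁, F.combination_apply, F.combination_apply]
    simp only [Complex.sub_im, Complex.mul_im, Complex.sub_re, Complex.add_re, Complex.add_im,
      Complex.mul_re, Complex.ofReal_re, Complex.ofReal_im, Complex.conj_re, Complex.conj_im]
    linear_combination (-1 : ℝ) * h0 + ((P x).re * (Q x).im - (P x).im * (Q x).re) * h1
  -- The `(T,U)` and `(T,V)` components of the structure equation give `i φ(T) = D₁ conj Q - D₂ conj
  -- P` and `conj A = i (P D₂ - Q D₁)`. The `(U,V)` component `D₃ = P φ(V) - Q φ(U)` has exactly one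
  -- solution with `φ(U) = iu`, `φ(V) = iv` imaginary.
  let r : M → ℝ := fun x => (D₁ x * conj (Q x) - D₂ x * conj (P x)).re
  let u : M → ℝ := fun x => 2 * (D₃ x * conj (P x)).re
  let v : M → ℝ := fun x => 2 * (D₃ x * conj (Q x)).re
  have cP := fun x => contMDiffAt_conj (hP x)
  have cQ := fun x => contMDiffAt_conj (hQ x)
  have sr : ∀ x, ContMDiffAt (𝓡 3) 𝓘(ℝ, ℝ) ∞ r x := fun x =>
    contMDiffAt_re ((ContMDiffAt.complex_mul (s₁ x) (cQ x)).sub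
      (ContMDiffAt.complex_mul (s₂ x) (cP x)))
  have su : ∀ x, ContMDiffAt (𝓡 3) 𝓘(ℝ, ℝ) ∞ u x := fun x =>
    contMDiffAt_const.mul (contMDiffAt_re (ContMDiffAt.complex_mul (s₃ x) (cP x)))
  have sv : ∀ x, ContMDiffAt (𝓡 3) 𝓘(ℝ, ℝ) ∞ v x := fun x =>
    contMDiffAt_const.mul (contMDiffAt_re (ContMDiffAt.complex_mul (s₃ x) (cQ x)))
  let ψ : OneForm M ℝ := fun x => -r x • θ x + u x • F.α x + v x • F.β x
  let φ : OneForm M ℂ := fun x => Complex.I • Complex.ofRealCLM.comp (ψ x)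
  have hφ : ∀ x w, φ x w = Complex.I * ((-r x * θ x w + u x * F.α x w + v x * F.β x w : ℝ) : ℂ) :=
    fun x w => by simp [φ, ψ]; ring
  refine ⟨φ, fun x => conj (Complex.I * (P x * D₂ x - Q x * D₁ x)), ?_, ?_, ?_⟩
  · refine SmoothFormAt.smoothForm fun x _ => smoothFormAt_of_apply fun X hX => ?_
    simp only [hφ]
    refine ContMDiffAt.complex_mul contMDiffAt_const (contMDiffAt_ofReal ?_)
    exact (((sr x).neg.mul ((hF.smoothAt_θ x).apply hX)).add
      ((su x).mul ((hF.smoothAt_α x).apply hX))).add ((sv x).mul ((hF.smoothAt_β x).apply hX))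
  · intro x _ w w'
    rw [hF.dForm_eq θ₁ x w w']
    change _ • D₁ x + _ • D₂ x + _ • D₃ x = _
    have hN : P x * conj (Q x) - Q x * conj (P x) = -Complex.I := by
      apply Complex.ext
      · simp; ring
      · simp; linarith [hPQ x]
    have hr : (r x : ℂ) = D₁ x * conj (Q x) - D₂ x * conj (P x) :=
      Complex.ext rfl (by rw [htr x]; simp)
    have hu : (u x : ℂ) = D₃ x * conj (P x) + conj (D₃ x) * P x := by
      apply Complex.ext <;> simp [u] <;> ring
    have hv : (v x : ℂ) = D₃ x * conj (Q x) + conj (D₃ x) * Q x := by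
      apply Complex.ext <;> simp [v] <;> ring
    rw [hθ₁, F.combination_apply, F.combination_apply, hφ, hφ]
    simp only [Complex.real_smul, Complex.ofReal_add, Complex.ofReal_sub, Complex.ofReal_mul,
      Complex.ofReal_neg, map_add, map_mul, Complex.conj_conj, Complex.conj_ofReal, hr, hu, hv]
    have hI : Complex.I * (P x * conj (Q x) - Q x * conj (P x)) = 1 := by
      rw [hN]; simp
    linear_combination
      (-((θ x w * F.α x w' - θ x w' * F.α x w : ℂ) * D₁ x +
        (θ x w * F.β x w' - θ x w' * F.β x w : ℂ) * D₂ x +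
        (F.α x w * F.β x w' - F.α x w' * F.β x w : ℂ) * D₃ x)) * hI
  · intro x _ w
    rw [hφ]
    simp only [map_mul, Complex.conj_I, Complex.conj_ofReal]
    ring

end IsContactFrame

/-! ### The complex structure and unitary coframe given by `a` and `c` -/

lemma complexStructure_apply {ξ : PlaneField M} (F : Frame ξ) (a c : M → ℝ) (x : M) (v : ξ x) :
    F.complexStructure a c x v =
      F.α x v • (a x • F.U x + c x • F.V x) +
        F.β x v • (-((1 + a x ^ 2) / c x) • F.U x - a x • F.V x) :=
  rfl

/-- The coefficient of `α` in `Frame.complexCoframe`. -/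
def coframeAlpha (a c : M → ℝ) : M → ℂ := fun x =>
  (Real.sqrt (2 * c x * (a x ^ 2 + 1)) : ℝ) * (-Complex.I / (2 * ((a x : ℂ) - Complex.I)))

/-- The coefficient of `β` in `Frame.complexCoframe`. -/
def coframeBeta (a c : M → ℝ) : M → ℂ := fun x =>
  (Real.sqrt (2 * c x * (a x ^ 2 + 1)) : ℝ) * (Complex.I / (2 * (c x : ℂ)))

lemma complexCoframe_eq {ξ : PlaneField M} (F : Frame ξ) (a c : M → ℝ) :
    F.complexCoframe a c = F.combination (coframeAlpha a c) (coframeBeta a c) := by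
  funext x
  simp only [Frame.complexCoframe, Frame.combination, coframeAlpha, coframeBeta, smul_add, smul_smul]

omit [TopologicalSpace M] [ChartedSpace E3 M] in
-- With a real denominator, smoothness and the real and imaginary parts can be read off.
lemma coframeAlpha_eq (a c : M → ℝ) (x : M) : coframeAlpha a c x =
    ((Real.sqrt (2 * c x * (a x ^ 2 + 1)) / (2 * (a x ^ 2 + 1)) : ℝ) : ℂ) *
      (1 - (a x : ℂ) * Complex.I) := by
  have h1 : ((a x : ℂ) ^ 2 + 1) ≠ 0 := by
    have : (a x ^ 2 + 1 : ℝ) ≠ 0 := by positivity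
    exact_mod_cast this
  have h2 : (a x : ℂ) - Complex.I ≠ 0 := by
    intro h
    have := congrArg Complex.im h
    simp at this
  rw [coframeAlpha]
  push_cast
  field_simp
  linear_combination (-((Real.sqrt (2 * c x * (a x ^ 2 + 1)) : ℝ) : ℂ) * (a x : ℂ)) * Complex.I_sq

omit [TopologicalSpace M] [ChartedSpace E3 M] in
lemma coframeBeta_eq (a c : M → ℝ) (x : M) : coframeBeta a c x =
    ((Real.sqrt (2 * c x * (a x ^ 2 + 1)) / (2 * c x) : ℝ) : ℂ) * Complex.I := by
  rw [coframeBeta]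
  push_cast
  ring

omit [TopologicalSpace M] [ChartedSpace E3 M] in
-- The square root in the coframe is chosen for this normalization, which turns complex linearity
-- into unitarity.
lemma coframe_det {a c : M → ℝ} {x : M} (hc : 0 < c x) :
    (coframeAlpha a c x).re * (coframeBeta a c x).im -
      (coframeAlpha a c x).im * (coframeBeta a c x).re = 1 / 2 := by
  have h1 : (0 : ℝ) < a x ^ 2 + 1 := by positivity
  have hs : Real.sqrt (2 * c x * (a x ^ 2 + 1)) ^ 2 = 2 * c x * (a x ^ 2 + 1) :=
    Real.sq_sqrt (by positivity)
  rw [coframeAlpha_eq, coframeBeta_eq]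
  simp only [Complex.mul_re, Complex.mul_im, Complex.ofReal_re, Complex.ofReal_im, Complex.I_re,
    Complex.I_im, Complex.sub_re, Complex.sub_im, Complex.one_re, Complex.one_im]
  field_simp
  linear_combination hs

omit [TopologicalSpace M] [ChartedSpace E3 M] in
-- This is `θ¹(JU) = i θ¹(U)`; the same relation for `V` follows from `J² = -1`.
lemma coframe_linear {a c : M → ℝ} {x : M} (hc : 0 < c x) :
    (c x : ℂ) * coframeBeta a c x = (Complex.I - a x) * coframeAlpha a c x := by
  have h1 : ((a x : ℂ) ^ 2 + 1) ≠ 0 := by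
    have : (a x ^ 2 + 1 : ℝ) ≠ 0 := by positivity
    exact_mod_cast this
  have h2 : (c x : ℂ) ≠ 0 := by exact_mod_cast hc.ne'
  rw [coframeAlpha_eq, coframeBeta_eq]
  push_cast
  field_simp
  linear_combination (((Real.sqrt (2 * c x * (a x ^ 2 + 1)) : ℝ) : ℂ) * (a x : ℂ)) * Complex.I_sq

lemma contMDiffAt_div {f g : M → ℝ} {x : M} (hf : ContMDiffAt (𝓡 3) 𝓘(ℝ, ℝ) ∞ f x)
    (hg : ContMDiffAt (𝓡 3) 𝓘(ℝ, ℝ) ∞ g x) (h0 : g x ≠ 0) :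
    ContMDiffAt (𝓡 3) 𝓘(ℝ, ℝ) ∞ (fun y => f y / g y) x := by
  simp only [div_eq_mul_inv]
  exact hf.mul ((contDiffAt_inv ℝ h0).contMDiffAt.comp x hg)

lemma contMDiffAt_sqrt {f : M → ℝ} {x : M} (hf : ContMDiffAt (𝓡 3) 𝓘(ℝ, ℝ) ∞ f x)
    (h0 : f x ≠ 0) : ContMDiffAt (𝓡 3) 𝓘(ℝ, ℝ) ∞ (fun y => Real.sqrt (f y)) x :=
  (Real.contDiffAt_sqrt h0).contMDiffAt.comp x hf

lemma contMDiffAt_coframeAlpha {a c : M → ℝ} {x : M} (ha : ContMDiffAt (𝓡 3) 𝓘(ℝ, ℝ) ∞ a x)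
    (hc : ContMDiffAt (𝓡 3) 𝓘(ℝ, ℝ) ∞ c x) (h0 : 0 < c x) :
    ContMDiffAt (𝓡 3) 𝓘(ℝ, ℂ) ∞ (coframeAlpha a c) x := by
  rw [show coframeAlpha a c = _ from funext (coframeAlpha_eq a c)]
  have h1 : ContMDiffAt (𝓡 3) 𝓘(ℝ, ℝ) ∞ (fun x => a x ^ 2 + 1) x :=
    (ha.pow 2).add contMDiffAt_const
  refine ContMDiffAt.complex_mul (contMDiffAt_ofReal (contMDiffAt_div (contMDiffAt_sqrt
    ((contMDiffAt_const.mul hc).mul h1) (by positivity)) (contMDiffAt_const.mul h1)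
    (by positivity))) (contMDiffAt_const.sub
      (ContMDiffAt.complex_mul (contMDiffAt_ofReal ha) contMDiffAt_const))

lemma contMDiffAt_coframeBeta {a c : M → ℝ} {x : M} (ha : ContMDiffAt (𝓡 3) 𝓘(ℝ, ℝ) ∞ a x)
    (hc : ContMDiffAt (𝓡 3) 𝓘(ℝ, ℝ) ∞ c x) (h0 : 0 < c x) :
    ContMDiffAt (𝓡 3) 𝓘(ℝ, ℂ) ∞ (coframeBeta a c) x := by
  rw [show coframeBeta a c = _ from funext (coframeBeta_eq a c)]
  have h1 : ContMDiffAt (𝓡 3) 𝓘(ℝ, ℝ) ∞ (fun x => a x ^ 2 + 1) x :=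
    (ha.pow 2).add contMDiffAt_const
  exact ContMDiffAt.complex_mul (contMDiffAt_ofReal (contMDiffAt_div (contMDiffAt_sqrt
    ((contMDiffAt_const.mul hc).mul h1) (by positivity)) (contMDiffAt_const.mul hc)
    (by positivity))) contMDiffAt_const

namespace IsContactFrame

variable [IsManifold (𝓡 3) ∞ M] {ξ : PlaneField M} {θ : OneForm M ℝ} {F : Frame ξ}
  (hF : IsContactFrame θ F) {a c : M → ℝ}

include hF

lemma α_complexStructure (x : M) (v : ξ x) : F.α x (F.complexStructure a c x v) =
    a x * F.α x v - (1 + a x ^ 2) / c x * F.β x v := by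
  rw [complexStructure_apply]
  simp [(hF.α_dual x).2.1, (hF.α_dual x).2.2]
  ring

lemma β_complexStructure (x : M) (v : ξ x) : F.β x (F.complexStructure a c x v) =
    c x * F.α x v - a x * F.β x v := by
  rw [complexStructure_apply]
  simp [(hF.β_dual x).2.1, (hF.β_dual x).2.2]
  ring

lemma plane_ext {x : M} {v w : ξ x} (h₁ : F.α x v = F.α x w) (h₂ : F.β x v = F.β x w) : v = w :=
  Subtype.ext (hF.eq_of_coframe_eq
    (by rw [(hF.ker_eq x _).1 v.2, (hF.ker_eq x _).1 w.2]) h₁ h₂)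

lemma eq_T_of_isReebAt {x : M} {v : TangentSpace (𝓡 3) x} (hv : IsReebAt θ x v) : v = F.T x := by
  have h1 := hv.2 (F.U x)
  have h2 := hv.2 (F.V x)
  rw [hF.d_theta, (hF.α_dual x).2.1, (hF.β_dual x).2.1] at h1
  rw [hF.d_theta, (hF.α_dual x).2.2, (hF.β_dual x).2.2] at h2
  refine hF.eq_of_coframe_eq ?_ ?_ ?_
  · rw [hv.1, (hF.θ_dual x).1]
  · rw [(hF.α_dual x).1]; linarith
  · rw [(hF.β_dual x).1]; linarith

lemma isPseudohermitian (ha : ContMDiff (𝓡 3) 𝓘(ℝ, ℝ) ∞ a) (hc : ContMDiff (𝓡 3) 𝓘(ℝ, ℝ) ∞ c)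
    (h0 : ∀ x, 0 < c x) : IsPseudohermitian ξ (F.complexStructure a c) θ where
  smooth_form := hF.smooth_θ
  ker_eq := hF.ker_eq
  contact x := by
    refine ⟨F.T x, F.U x, F.V x, ?_⟩
    rw [(hF.θ_dual x).1, (hF.θ_dual x).2.1, (hF.θ_dual x).2.2, hF.d_theta,
      (hF.α_dual x).2.1, (hF.β_dual x).2.2, (hF.α_dual x).2.2]
    norm_num
  smooth_J O X hO hX := by
    refine SmoothVFieldAt.smoothVField fun x hx => ?_
    have hX' := hX.at hO hx
    have hα := (hF.smoothAt_α x).apply hX'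
    have hβ := (hF.smoothAt_β x).apply hX'
    have key := ((hF.smoothAt_U x).smul (ha x)).add ((hF.smoothAt_V x).smul (hc x))
    have key' := ((hF.smoothAt_U x).smul
      (contMDiffAt_div ((contMDiffAt_const (c := (1 : ℝ))).add ((ha x).pow 2)) (hc x) (h0 x).ne').neg).sub
        ((hF.smoothAt_V x).smul (ha x))
    exact (key.smul hα).add (key'.smul hβ)
  J_sq x v := by
    have := (h0 x).ne'
    apply hF.plane_ext
    · simp only [hF.α_complexStructure, hF.β_complexStructure, Submodule.coe_neg, map_neg]
      field_simp
      ring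
    · simp only [hF.α_complexStructure, hF.β_complexStructure, Submodule.coe_neg, map_neg]
      field_simp
      ring
  compatible x v w := by
    have := (h0 x).ne'
    simp only [hF.d_theta, hF.α_complexStructure, hF.β_complexStructure]
    field_simp
    ring
  pos x v hv := by
    have hc := h0 x
    simp only [hF.d_theta, hF.α_complexStructure, hF.β_complexStructure]
    -- Completing the square; the denominator shows where the sign of `c` enters.
    have h : F.α x v * (c x * F.α x v - a x * F.β x v) -
        (a x * F.α x v - (1 + a x ^ 2) / c x * F.β x v) * F.β x v =
        ((c x * F.α x v - a x * F.β x v) ^ 2 + F.β x v ^ 2) / c x := by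
      field_simp
      ring
    rw [h]
    refine div_pos ?_ hc
    by_contra hneg
    have h2 : F.β x v = 0 := by
      nlinarith [sq_nonneg (c x * F.α x v - a x * F.β x v),
        sq_nonneg (F.β x v)]
    have h1 : F.α x v = 0 := by
      rw [h2] at hneg
      have : (c x * F.α x v) ^ 2 ≤ 0 := by nlinarith
      have : c x * F.α x v = 0 := by nlinarith [sq_nonneg (c x * F.α x v)]
      exact (mul_eq_zero.1 this).resolve_left hc.ne'
    exact hv (hF.plane_ext (by simpa using h1) (by simpa using h2))

lemma isAdmissibleCoframe (ha : ContMDiff (𝓡 3) 𝓘(ℝ, ℝ) ∞ a)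
    (hc : ContMDiff (𝓡 3) 𝓘(ℝ, ℝ) ∞ c) (h0 : ∀ x, 0 < c x) :
    IsAdmissibleCoframe ξ (F.complexStructure a c) θ univ (F.complexCoframe a c) where
  smooth := by
    rw [complexCoframe_eq]
    exact SmoothFormAt.smoothForm fun x _ => hF.smoothAt_combination
      (contMDiffAt_coframeAlpha (ha x) (hc x) (h0 x))
      (contMDiffAt_coframeBeta (ha x) (hc x) (h0 x))
  reeb x _ v hv := by
    rw [hF.eq_T_of_isReebAt hv, complexCoframe_eq, F.combination_apply, (hF.α_dual x).1,
      (hF.β_dual x).1]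
    simp
  complex_linear x _ v := by
    have hl := coframe_linear (a := a) (h0 x)
    have h2 : (c x : ℂ) ≠ 0 := by exact_mod_cast (h0 x).ne'
    rw [complexCoframe_eq, F.combination_apply, F.combination_apply, hF.α_complexStructure,
      hF.β_complexStructure]
    push_cast
    field_simp
    have hI := Complex.I_sq
    linear_combination (c x * F.α x v - (Complex.I + a x) * F.β x v : ℂ) * hl +
      (-(coframeAlpha a c x * F.β x v) : ℂ) * hI
  levi x _ v w := by
    have hd := coframe_det (a := a) (h0 x)
    rw [complexCoframe_eq, F.combination_apply, F.combination_apply, hF.d_theta]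
    have hN : Complex.I * (coframeAlpha a c x * conj (coframeBeta a c x) -
        coframeBeta a c x * conj (coframeAlpha a c x)) = 1 := by
      apply Complex.ext
      · simp; linarith
      · simp; ring
    simp only [map_add, map_mul, Complex.conj_ofReal]
    push_cast
    linear_combination (-(F.α x v * F.β x w - F.α x w * F.β x v : ℂ)) * hN

end IsContactFrame

/-! ### Uniqueness of the torsion -/

/-- If `θ¹` vanished on a non-zero `v` in `ξ`, the Levi equation would give `dθ(v, Jv) = 0`, against
positivity. -/
lemma IsAdmissibleCoframe.injective [IsManifold (𝓡 3) ∞ M] {ξ : PlaneField M} {J : PlaneEndo ξ}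
    {θ : OneForm M ℝ} {O : Set M} {θ₁ : OneForm M ℂ} (h : IsAdmissibleCoframe ξ J θ O θ₁)
    (hJ : IsPseudohermitian ξ J θ) {x : M} (hx : x ∈ O) {v w : ξ x} (hvw : θ₁ x v = θ₁ x w) :
    v = w := by
  by_contra hne
  have hu := hJ.pos x (v - w) (sub_ne_zero.2 hne)
  have h0 : θ₁ x (v - w : ξ x) = 0 := by
    rw [Submodule.coe_sub, map_sub, hvw, sub_self]
  have hl := h.levi x hx (v - w : ξ x) (J x (v - w))
  rw [h.complex_linear x hx, h0] at hl
  simp only [mul_zero, map_zero, sub_self] at hl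
  exact hu.ne' (by exact_mod_cast hl)

namespace IsContactFrame

variable [IsManifold (𝓡 3) ∞ M] {ξ : PlaneField M} {θ : OneForm M ℝ} {F : Frame ξ}
  (hF : IsContactFrame θ F) {a c : M → ℝ}

include hF

lemma bracket_T_mem (X : ∀ x, ξ x)
    (hX : ∀ y, SmoothVFieldAt (fun y => (X y : TangentSpace (𝓡 3) y)) y) (x : M) :
    VectorField.mlieBracket (𝓡 3) F.T (fun y => (X y : TangentSpace (𝓡 3) y)) x ∈ ξ x := by
  rw [hF.ker_eq, hF.θ_bracket (hF.smoothAt_T x) (hX x) (fun y => (hF.θ_dual y).1)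
    (fun y => (hF.ker_eq y _).1 (X y).2), (hF.α_dual x).1, (hF.β_dual x).1]
  ring

/-- The torsion is determined by the Lie derivative of `J` along the Reeb field. -/
lemma torsion_apply {J : PlaneEndo ξ} (hJ : IsPseudohermitian ξ J θ) (X : ∀ x, ξ x)
    (hX : ∀ y, SmoothVFieldAt (fun y => (X y : TangentSpace (𝓡 3) y)) y)
    (hY : ∀ y, SmoothVFieldAt (fun y => (J y (X y) : TangentSpace (𝓡 3) y)) y) {x : M}
    {B : ξ x →ₗ[ℝ] ξ x} (hB : IsTorsionAt ξ J θ x B) :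
    (2 : ℝ) • J x (B (X x)) = ⟨_, hF.bracket_T_mem (fun y => J y (X y)) hY x⟩ -
      J x ⟨_, hF.bracket_T_mem X hX x⟩ := by
  obtain ⟨O, θ₁, φ, A, hO, hx, hθ₁, hφ, hBA⟩ := hB
  have hs : SmoothFormAt θ₁ x := hθ₁.smooth.at hO hx
  have hOx : ∀ᶠ y in 𝓝 x, y ∈ O := hO.mem_nhds hx
  have hT : ∀ y ∈ O, θ₁ y (F.T y) = 0 := fun y hy => hθ₁.reeb y hy _ (hF.reeb y)
  have hT0 : differential (fun y => θ₁ y (F.T y)) x = 0 := by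
    rw [differential_congr (g := fun _ => 0) (hOx.mono hT), differential_const]
  -- The structure equation on `(T, Z)`, solved for the torsion. Passing from `Z = X` to `Z = JX`
  -- multiplies the derivative and connection terms by `i` and the torsion by `-i`; so `i` times the
  -- first equation minus the second eliminates the former and doubles the latter.
  have e : ∀ Z : ∀ x, ξ x, (∀ y, SmoothVFieldAt (fun y => (Z y : TangentSpace (𝓡 3) y)) y) →
      θ₁ x (B (Z x)) = differential (fun y => θ₁ y (Z y)) x (F.T x) -
        θ₁ x (VectorField.mlieBracket (𝓡 3) F.T (fun y => (Z y : TangentSpace (𝓡 3) y)) x) +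
        θ₁ x (Z x) * φ x (F.T x) := by
    intro Z hZ
    have h1 := dForm_apply hs (hF.smoothAt_T x) (hZ x)
    have h2 := hφ.structure_eq x hx (F.T x) (Z x)
    rw [hT0] at h1
    rw [h1, hT x hx, (hF.θ_dual x).1, (hF.ker_eq x _).1 (Z x).2] at h2
    rw [hBA]
    simp only [_root_.zero_apply, map_mul, map_zero, mul_zero, zero_mul, Complex.ofReal_zero,
      Complex.ofReal_one, sub_zero, one_mul, zero_sub] at h2
    linear_combination -h2
  have eX := e X hX
  have eY := e (fun y => J y (X y)) hY
  have hd : differential (fun y => θ₁ y (J y (X y))) x (F.T x) =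
      Complex.I * differential (fun y => θ₁ y (X y)) x (F.T x) := by
    rw [differential_congr (g := fun y => Complex.I * θ₁ y (X y))
      (hOx.mono fun y hy => hθ₁.complex_linear y hy _)]
    exact differential_clm_comp (ContinuousLinearMap.mul ℝ ℂ Complex.I)
      ((hs.apply (hX x)).mdifferentiableAt (by simp)) _
  have hBY : θ₁ x (B (J x (X x))) = -Complex.I * θ₁ x (B (X x)) := by
    rw [hBA, hBA, hθ₁.complex_linear x hx, map_mul, Complex.conj_I]
    ring
  rw [hBY, hd, hθ₁.complex_linear x hx] at eY
  apply hθ₁.injective hJ hx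
  rw [Submodule.coe_sub, map_sub, hθ₁.complex_linear x hx, Submodule.coe_smul, map_smul,
    hθ₁.complex_linear x hx, Complex.real_smul]
  push_cast
  linear_combination -eY + Complex.I * eX

/-- The right-hand side of `torsion_apply` involves no coframe, so the choice made in
`torsionTensor` is immaterial. -/
lemma torsion_unique {J : PlaneEndo ξ} (hJ : IsPseudohermitian ξ J θ) {x : M}
    {B B' : ξ x →ₗ[ℝ] ξ x} (hB : IsTorsionAt ξ J θ x B) (hB' : IsTorsionAt ξ J θ x B') : B = B' := by
  have key : ∀ X : ∀ x, ξ x, (∀ y, SmoothVFieldAt (fun y => (X y : TangentSpace (𝓡 3) y)) y) →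
      B (X x) = B' (X x) := by
    intro X hX
    have hY := smoothVField_univ_iff.1 (hJ.smooth_J univ X isOpen_univ (smoothVField_univ_iff.2 hX))
    have h := (hF.torsion_apply hJ X hX hY hB).trans (hF.torsion_apply hJ X hX hY hB').symm
    have h2 := congrArg (J x) (smul_right_injective _ (two_ne_zero (α := ℝ)) h)
    rw [hJ.J_sq, hJ.J_sq] at h2
    exact neg_injective h2
  refine LinearMap.ext fun v => ?_
  rw [hF.decomp_plane v]
  simp only [map_add, map_smul, key F.U hF.smoothAt_U, key F.V hF.smoothAt_V]

lemma torsionTensor_eq {J : PlaneEndo ξ} (hJ : IsPseudohermitian ξ J θ) {x : M}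
    {B : ξ x →ₗ[ℝ] ξ x} (hB : IsTorsionAt ξ J θ x B) : torsionTensor ξ J θ x = B :=
  hF.torsion_unique hJ (Classical.epsilon_spec ⟨B, hB⟩) hB

/-- Weighting the `(T,U)` and `(T,V)` components by `Q` and `-P` eliminates the connection form and
leaves a non-zero multiple of `conj A - conj A'`. -/
lemma torsionCoeff_unique {P Q : M → ℂ} {O : Set M} {φ φ' : OneForm M ℂ} {A A' : M → ℂ}
    (hPQ : ∀ x, (P x).re * (Q x).im - (P x).im * (Q x).re = 1 / 2)
    (h : IsTanakaWebster θ O (F.combination P Q) φ A)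
    (h' : IsTanakaWebster θ O (F.combination P Q) φ' A') {x : M} (hx : x ∈ O) : A x = A' x := by
  have h1 := (h.structure_eq x hx (F.T x) (F.U x)).symm.trans
    (h'.structure_eq x hx (F.T x) (F.U x))
  have h2 := (h.structure_eq x hx (F.T x) (F.V x)).symm.trans
    (h'.structure_eq x hx (F.T x) (F.V x))
  simp only [F.combination_apply, hF.θ_dual x, hF.α_dual x, hF.β_dual x, Complex.ofReal_zero,
    Complex.ofReal_one, mul_zero, mul_one, add_zero, zero_add, zero_mul, zero_sub, one_mul,
    map_mul, sub_zero] at h1 h2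
  have hN : conj (P x) * Q x - conj (Q x) * P x = Complex.I := by
    apply Complex.ext
    · simp; ring
    · simp; linarith [hPQ x]
  have h3 : Complex.I * (conj (A x) - conj (A' x)) = 0 := by
    linear_combination Q x * h1 - P x * h2 - (conj (A x) - conj (A' x)) * hN
  have h4 := (mul_eq_zero.1 h3).resolve_left Complex.I_ne_zero
  exact (starRingEnd ℂ).injective (sub_eq_zero.1 h4)

/-- `torsionCoeff` chooses a value at each point separately; by uniqueness these values belong to
one and the same connection. -/
lemma exists_isTanakaWebster_torsionCoeff (ha : ContMDiff (𝓡 3) 𝓘(ℝ, ℝ) ∞ a)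
    (hc : ContMDiff (𝓡 3) 𝓘(ℝ, ℝ) ∞ c) (h0 : ∀ x, 0 < c x) :
    ∃ φ : OneForm M ℂ, IsTanakaWebster θ univ (F.complexCoframe a c) φ
      (torsionCoeff θ (F.complexCoframe a c)) := by
  have hdet : ∀ x, (coframeAlpha a c x).re * (coframeBeta a c x).im -
      (coframeAlpha a c x).im * (coframeBeta a c x).re = 1 / 2 := fun x => coframe_det (h0 x)
  rw [complexCoframe_eq]
  obtain ⟨φ, A, h⟩ := hF.exists_isTanakaWebster
    (fun x => contMDiffAt_coframeAlpha (ha x) (hc x) (h0 x))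
    (fun x => contMDiffAt_coframeBeta (ha x) (hc x) (h0 x)) hdet
  have hA : torsionCoeff θ (F.combination (coframeAlpha a c) (coframeBeta a c)) = A := by
    funext x
    obtain ⟨φ', A', h', hA'⟩ := Classical.epsilon_spec (p := fun z => ∃ (φ : OneForm M ℂ)
      (A : M → ℂ), IsTanakaWebster θ univ (F.combination (coframeAlpha a c) (coframeBeta a c))
        φ A ∧ A x = z) ⟨A x, φ, A, h, rfl⟩
    exact hA'.symm.trans (hF.torsionCoeff_unique hdet h' h (mem_univ x))
  rw [hA]
  exact ⟨φ, h⟩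

end IsContactFrame

/-! ### The torsion tensor as a matrix -/

/-- The right-hand side of the evolution equation of `a`, without the factor `2`. -/
def torsionU (A : ℂ) (a : ℝ) : ℝ := A.re + a * A.im

/-- The right-hand side of the evolution equation of `c`, without the factor `2`. -/
def torsionV (A : ℂ) (a c : ℝ) : ℝ :=
  -(A.re * (-2 * a * c / (a ^ 2 + 1)) + A.im * ((1 - a ^ 2) * c / (a ^ 2 + 1)))

/-- The derivative of `-(1 + a²) / c` when `a` and `c` have derivatives `torsionU`
and `torsionV`. -/
def torsionW (A : ℂ) (a c : ℝ) : ℝ :=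
  -(2 * a * torsionU A a * c - (1 + a ^ 2) * torsionV A a c) / c ^ 2

/-- The torsion tensor of `Frame.complexStructure a c`, in terms of the torsion coefficient `A`
in the coframe `Frame.complexCoframe a c`. -/
def Frame.torsionEndo {ξ : PlaneField M} (F : Frame ξ) (A : M → ℂ) (a c : M → ℝ) : PlaneEndo ξ :=
  fun x =>
    ((F.α x : TangentSpace (𝓡 3) x →ₗ[ℝ] ℝ).comp (ξ x).subtype).smulRight
      (torsionU (A x) (a x) • F.U x + torsionV (A x) (a x) (c x) • F.V x) +
    ((F.β x : TangentSpace (𝓡 3) x →ₗ[ℝ] ℝ).comp (ξ x).subtype).smulRight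
      (torsionW (A x) (a x) (c x) • F.U x - torsionU (A x) (a x) • F.V x)

lemma torsionEndo_apply {ξ : PlaneField M} (F : Frame ξ) (A : M → ℂ) (a c : M → ℝ) (x : M)
    (v : ξ x) : F.torsionEndo A a c x v =
      F.α x v • (torsionU (A x) (a x) • F.U x + torsionV (A x) (a x) (c x) • F.V x) +
        F.β x v • (torsionW (A x) (a x) (c x) • F.U x - torsionU (A x) (a x) • F.V x) :=
  rfl

namespace IsContactFrame

variable [IsManifold (𝓡 3) ∞ M] {ξ : PlaneField M} {θ : OneForm M ℝ} {F : Frame ξ}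
  (hF : IsContactFrame θ F) {a c : M → ℝ}

include hF

/-- The entries of `torsionEndo` solve `θ¹ ∘ B = conj A · conj θ¹` on `U` and `V`. Such a `B` is
antilinear, hence tangent to the matrices with `J² = -1`, which is why `torsionW` has the form of a
derivative. -/
lemma coframe_torsionEndo (h0 : ∀ x, 0 < c x) (A : M → ℂ) (x : M) (v : ξ x) :
    F.complexCoframe a c x (F.torsionEndo A a c x v) =
      conj (A x) * conj (F.complexCoframe a c x v) := by
  have hc : (c x : ℂ) ≠ 0 := by exact_mod_cast (h0 x).ne'
  have h1 : ((a x : ℂ) ^ 2 + 1) ≠ 0 := by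
    have : (a x ^ 2 + 1 : ℝ) ≠ 0 := by positivity
    exact_mod_cast this
  have hA : A x = (A x).re + (A x).im * Complex.I := (Complex.re_add_im _).symm
  rw [torsionEndo_apply, complexCoframe_eq, F.combination_apply, F.combination_apply]
  simp only [Submodule.coe_add, Submodule.coe_sub, Submodule.coe_smul, map_add, map_sub, map_smul,
    hF.α_dual x, hF.β_dual x, map_mul, Complex.conj_ofReal, coframeAlpha_eq, coframeBeta_eq,
    Complex.conj_I, smul_eq_mul, torsionW, torsionV, torsionU, map_one]
  rw [hA]
  simp only [map_add, map_mul, Complex.conj_ofReal, Complex.conj_I, Complex.add_re, Complex.add_im,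
    Complex.mul_re, Complex.mul_im, Complex.ofReal_re, Complex.ofReal_im, Complex.I_re,
    Complex.I_im]
  push_cast
  field_simp
  ring_nf
  simp only [Complex.I_sq]
  ring

lemma torsionTensor_complexStructure (ha : ContMDiff (𝓡 3) 𝓘(ℝ, ℝ) ∞ a)
    (hc : ContMDiff (𝓡 3) 𝓘(ℝ, ℝ) ∞ c) (h0 : ∀ x, 0 < c x) :
    torsionTensor ξ (F.complexStructure a c) θ =
      F.torsionEndo (torsionCoeff θ (F.complexCoframe a c)) a c := by
  funext x
  obtain ⟨φ, hφ⟩ := hF.exists_isTanakaWebster_torsionCoeff ha hc h0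
  exact hF.torsionTensor_eq (hF.isPseudohermitian ha hc h0) ⟨univ, _, φ, _, isOpen_univ, mem_univ x,
    hF.isAdmissibleCoframe ha hc h0, hφ, hF.coframe_torsionEndo h0 _ x⟩

end IsContactFrame

/-! ### Deformation of the contact form -/

lemma coframe_basis_of_dual {E : Type*} [AddCommGroup E] [Module ℝ E] [TopologicalSpace E]
    {θ α β : E →L[ℝ] ℝ} {T U V : E} (hθ : θ T = 1 ∧ θ U = 0 ∧ θ V = 0)
    (hα : α T = 0 ∧ α U = 1 ∧ α V = 0) (hβ : β T = 0 ∧ β U = 0 ∧ β V = 1)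
    (hdec : ∀ v, v = θ v • T + α v • U + β v • V) :
    LinearIndependent ℝ ![θ, α, β] ∧ Submodule.span ℝ (Set.range ![θ, α, β]) = ⊤ := by
  constructor
  · rw [Fintype.linearIndependent_iff]
    intro g hg
    have h : ∀ v, g 0 * θ v + g 1 * α v + g 2 * β v = 0 := fun v => by
      have := congrArg (fun L : E →L[ℝ] ℝ => L v) hg
      simpa [Fin.sum_univ_three] using this
    intro i
    fin_cases i
    · simpa [hθ, hα, hβ] using h T
    · simpa [hθ, hα, hβ] using h U
    · simpa [hθ, hα, hβ] using h V
  · rw [eq_top_iff]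
    rintro η -
    have : η = η T • θ + η U • α + η V • β := by
      ext v
      conv_lhs => rw [hdec v]
      simp
      ring
    rw [this]
    have hm : ∀ i, ![θ, α, β] i ∈ Submodule.span ℝ (Set.range ![θ, α, β]) := fun i =>
      Submodule.subset_span ⟨i, rfl⟩
    exact add_mem (add_mem (Submodule.smul_mem _ _ (hm 0)) (Submodule.smul_mem _ _ (hm 1)))
      (Submodule.smul_mem _ _ (hm 2))

lemma dirDeriv_eq (b : M → ℝ) (X : VField M) (x : M) :
    dirDeriv b X x = differential b x (X x) := rfl

section

variable {ξ : PlaneField M} {θ : OneForm M ℝ} {F : Frame ξ}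

lemma thetaB_apply (b : M → ℝ) (x : M) (v : TangentSpace (𝓡 3) x) :
    thetaB θ b x v = b x ^ 2 * θ x v := rfl

lemma sameCoorientation_thetaB {b : M → ℝ} (h0 : ∀ x, 0 < b x) :
    SameCoorientation θ (thetaB θ b) := fun x v hv => by
  rw [thetaB_apply]
  exact mul_pos (pow_pos (h0 x) 2) hv

lemma deform_α_apply (b : M → ℝ) (x : M) (v : TangentSpace (𝓡 3) x) :
    (F.deform θ b).α x v =
      b x * F.α x v - 2 * differential b x (F.V x) * θ x v := rfl

lemma deform_β_apply (b : M → ℝ) (x : M) (v : TangentSpace (𝓡 3) x) :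
    (F.deform θ b).β x v =
      b x * F.β x v + 2 * differential b x (F.U x) * θ x v := rfl

end

namespace IsContactFrame

variable [IsManifold (𝓡 3) ∞ M] {ξ : PlaneField M} {θ : OneForm M ℝ} {F : Frame ξ}
  (hF : IsContactFrame θ F) {b : M → ℝ}

include hF

/-- Here `dθ_b = 2b db ∧ θ + b² α ∧ β`. The part of `db` along `θ` drops out, and the multiples of
`θ` in `α_b`, `β_b` are those that absorb the rest. -/
lemma dForm_thetaB (hb : ContMDiff (𝓡 3) 𝓘(ℝ, ℝ) ∞ b) (x : M) (v w : TangentSpace (𝓡 3) x) :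
    dForm (thetaB θ b) x v w =
      (F.deform θ b).α x v * (F.deform θ b).β x w -
        (F.deform θ b).α x w * (F.deform θ b).β x v := by
  have hs : SmoothFormAt (thetaB θ b) x := smoothFormAt_of_apply fun X hX =>
    ((hb x).pow 2).mul ((hF.smoothAt_θ x).apply hX)
  have hd : ∀ u : TangentSpace (𝓡 3) x, differential (fun y => b y ^ 2) x u =
      2 * b x * differential b x u := fun u => by
    have hm := (hb x).mdifferentiableAt (by simp)
    simp only [pow_two]
    rw [differential_mul hm hm]
    ring
  have hT := hF.smoothAt_T x
  have hU := hF.smoothAt_U x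
  have hV := hF.smoothAt_V x
  have eT : (fun y => thetaB θ b y (F.T y)) = fun y => b y ^ 2 := by
    funext y; rw [thetaB_apply, (hF.θ_dual y).1, mul_one]
  have eU : (fun y => thetaB θ b y (F.U y)) = fun _ => 0 := by
    funext y; rw [thetaB_apply, (hF.θ_dual y).2.1, mul_zero]
  have eV : (fun y => thetaB θ b y (F.V y)) = fun _ => 0 := by
    funext y; rw [thetaB_apply, (hF.θ_dual y).2.2, mul_zero]
  have hθT : ∀ y, θ y (F.T y) = 1 := fun y => (hF.θ_dual y).1
  have hθU : ∀ y, θ y (F.U y) = 0 := fun y => (hF.θ_dual y).2.1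
  have hθV : ∀ y, θ y (F.V y) = 0 := fun y => (hF.θ_dual y).2.2
  rw [hF.dForm_eq, dForm_apply hs hT hU, dForm_apply hs hT hV, dForm_apply hs hU hV, eT, eU, eV,
    differential_const, thetaB_apply, thetaB_apply, thetaB_apply, hF.θ_bracket hT hU hθT hθU,
    hF.θ_bracket hT hV hθT hθV, hF.θ_bracket hU hV hθU hθV, hd, hd]
  simp only [hF.α_dual x, hF.β_dual x, deform_α_apply, deform_β_apply, _root_.zero_apply,
    smul_eq_mul]
  ring

lemma deform (hb : ContMDiff (𝓡 3) 𝓘(ℝ, ℝ) ∞ b) (h0 : ∀ x, 0 < b x) :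
    IsContactFrame (thetaB θ b) (F.deform θ b) := by
  have hne : ∀ x, b x ≠ 0 := fun x => (h0 x).ne'
  have hdU : ∀ x, ContMDiffAt (𝓡 3) 𝓘(ℝ, ℝ) ∞
      (dirDeriv b fun y => (F.U y : TangentSpace (𝓡 3) y)) x := fun x =>
    (smoothFormAt_differential (hb x)).apply (hF.smoothAt_U x)
  have hdV : ∀ x, ContMDiffAt (𝓡 3) 𝓘(ℝ, ℝ) ∞
      (dirDeriv b fun y => (F.V y : TangentSpace (𝓡 3) y)) x := fun x =>
    (smoothFormAt_differential (hb x)).apply (hF.smoothAt_V x)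
  have h1 : ∀ x, ContMDiffAt (𝓡 3) 𝓘(ℝ, ℝ) ∞ (fun y => 1 / b y) x := fun x =>
    contMDiffAt_div contMDiffAt_const (hb x) (hne x)
  have eT : ∀ (η : OneForm M ℝ) (x : M), η x ((F.deform θ b).T x) =
      1 / b x ^ 2 * η x (F.T x) + 2 * differential b x (F.V x) / b x ^ 3 * η x (F.U x) -
        2 * differential b x (F.U x) / b x ^ 3 * η x (F.V x) := fun η x => by
    simp only [Frame.deform, map_sub, map_add, map_smul, smul_eq_mul, dirDeriv_eq]
  have eU : ∀ (η : OneForm M ℝ) (x : M), η x ((F.deform θ b).U x) = 1 / b x * η x (F.U x) :=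
    fun η x => by simp only [Frame.deform, Submodule.coe_smul, map_smul, smul_eq_mul]
  have eV : ∀ (η : OneForm M ℝ) (x : M), η x ((F.deform θ b).V x) = 1 / b x * η x (F.V x) :=
    fun η x => by simp only [Frame.deform, Submodule.coe_smul, map_smul, smul_eq_mul]
  have hθd : ∀ x, thetaB θ b x ((F.deform θ b).T x) = 1 ∧
      thetaB θ b x ((F.deform θ b).U x) = 0 ∧ thetaB θ b x ((F.deform θ b).V x) = 0 := fun x => by
    have := hne x
    simp only [eT, eU, eV, thetaB_apply, hF.θ_dual x]
    refine ⟨?_, ?_, ?_⟩ <;> field_simp <;> ring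
  have hαd : ∀ x, (F.deform θ b).α x ((F.deform θ b).T x) = 0 ∧
      (F.deform θ b).α x ((F.deform θ b).U x) = 1 ∧
      (F.deform θ b).α x ((F.deform θ b).V x) = 0 := fun x => by
    have := hne x
    simp only [eT, eU, eV, deform_α_apply, hF.θ_dual x, hF.α_dual x]
    refine ⟨?_, ?_, ?_⟩ <;> field_simp <;> ring
  have hβd : ∀ x, (F.deform θ b).β x ((F.deform θ b).T x) = 0 ∧
      (F.deform θ b).β x ((F.deform θ b).U x) = 0 ∧
      (F.deform θ b).β x ((F.deform θ b).V x) = 1 := fun x => by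
    have := hne x
    simp only [eT, eU, eV, deform_β_apply, hF.θ_dual x, hF.β_dual x]
    refine ⟨?_, ?_, ?_⟩ <;> field_simp <;> ring
  have hdec : ∀ x (v : TangentSpace (𝓡 3) x), v = thetaB θ b x v • (F.deform θ b).T x +
      (F.deform θ b).α x v • ((F.deform θ b).U x : TangentSpace (𝓡 3) x) +
      (F.deform θ b).β x v • ((F.deform θ b).V x : TangentSpace (𝓡 3) x) := fun x v => by
    have := hne x
    apply hF.eq_of_coframe_eq <;>
    · simp only [map_add, map_smul, smul_eq_mul, eT, eU, eV, thetaB_apply, deform_α_apply,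
        deform_β_apply, hF.θ_dual x, hF.α_dual x, hF.β_dual x]
      field_simp
      ring
  refine { smooth_T := ?_, smooth_U := ?_, smooth_V := ?_, smooth_α := ?_, smooth_β := ?_,
           reeb := ?_, basis := ?_, θ_dual := hθd, α_dual := hαd, β_dual := hβd,
           d_theta := hF.dForm_thetaB hb, smooth_θ := ?_, ker_eq := ?_ }
  · refine smoothVField_univ_iff.2 fun x => ?_
    exact (((hF.smoothAt_T x).smul (contMDiffAt_div (contMDiffAt_const (c := (1 : ℝ)))
      ((hb x).pow 2) (pow_ne_zero 2 (hne x)))).add ((hF.smoothAt_U x).smul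
      (contMDiffAt_div ((contMDiffAt_const (c := (2 : ℝ))).mul (hdV x)) ((hb x).pow 3)
        (pow_ne_zero 3 (hne x))))).sub ((hF.smoothAt_V x).smul
      (contMDiffAt_div ((contMDiffAt_const (c := (2 : ℝ))).mul (hdU x)) ((hb x).pow 3)
        (pow_ne_zero 3 (hne x))))
  · exact smoothVField_univ_iff.2 fun x => (hF.smoothAt_U x).smul (h1 x)
  · exact smoothVField_univ_iff.2 fun x => (hF.smoothAt_V x).smul (h1 x)
  · refine smoothForm_univ_iff.2 fun x => smoothFormAt_of_apply fun X hX => ?_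
    exact ((hb x).mul ((hF.smoothAt_α x).apply hX)).sub
      (((contMDiffAt_const (c := (2 : ℝ))).mul (hdV x)).mul ((hF.smoothAt_θ x).apply hX))
  · refine smoothForm_univ_iff.2 fun x => smoothFormAt_of_apply fun X hX => ?_
    exact ((hb x).mul ((hF.smoothAt_β x).apply hX)).add
      (((contMDiffAt_const (c := (2 : ℝ))).mul (hdU x)).mul ((hF.smoothAt_θ x).apply hX))
  · refine fun x => ⟨(hθd x).1, fun w => ?_⟩
    rw [hF.dForm_thetaB hb, (hαd x).1, (hβd x).1]
    ring
  · exact fun x => coframe_basis_of_dual (hθd x) (hαd x) (hβd x) (hdec x)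
  · exact smoothForm_univ_iff.2 fun x => smoothFormAt_of_apply fun X hX =>
      ((hb x).pow 2).mul ((hF.smoothAt_θ x).apply hX)
  · intro x v
    rw [hF.ker_eq, thetaB_apply, mul_eq_zero, or_iff_right (pow_ne_zero 2 (hne x))]

/-- On `ξ` the forms `α_b`, `β_b` are `bα`, `bβ`, while `U_b`, `V_b` carry the factor `1/b`; the
scales cancel. -/
lemma deform_complexStructure (a c : M → ℝ) {x : M} (h0 : b x ≠ 0) :
    (F.deform θ b).complexStructure a c x = F.complexStructure a c x := by
  refine LinearMap.ext fun v => ?_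
  rw [complexStructure_apply, complexStructure_apply, deform_α_apply, deform_β_apply,
    (hF.ker_eq x _).1 v.2]
  simp only [Frame.deform]
  match_scalars <;> field_simp <;> ring

lemma deform_torsionEndo (A : M → ℂ) (a c : M → ℝ) {x : M} (h0 : b x ≠ 0) :
    (F.deform θ b).torsionEndo A a c x = F.torsionEndo A a c x := by
  refine LinearMap.ext fun v => ?_
  rw [torsionEndo_apply, torsionEndo_apply, deform_α_apply, deform_β_apply,
    (hF.ker_eq x _).1 v.2]
  simp only [Frame.deform]
  match_scalars <;> field_simp <;> ring

/-! ### Classification of the structures -/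

/-- The pseudohermitian structures with contact structure `ξ` are given by the three functions
`α (J' U)`, `√(θ' T)` and `β (J' U)`. -/
lemma classification {J' : PlaneEndo ξ} {θ' : OneForm M ℝ} (hJ' : IsPseudohermitian ξ J' θ')
    (hco : SameCoorientation θ θ') :
    ContMDiff (𝓡 3) 𝓘(ℝ, ℝ) ∞ (fun x => F.α x (J' x (F.U x))) ∧
    ContMDiff (𝓡 3) 𝓘(ℝ, ℝ) ∞ (fun x => Real.sqrt (θ' x (F.T x))) ∧
    ContMDiff (𝓡 3) 𝓘(ℝ, ℝ) ∞ (fun x => F.β x (J' x (F.U x))) ∧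
    (∀ x, 0 < θ' x (F.T x)) ∧ (∀ x, 0 < F.β x (J' x (F.U x))) ∧
    J' = F.complexStructure (fun x => F.α x (J' x (F.U x))) (fun x => F.β x (J' x (F.U x))) ∧
    θ' = thetaB θ (fun x => Real.sqrt (θ' x (F.T x))) := by
  have hJU := smoothVField_univ_iff.1 (hJ'.smooth_J univ F.U isOpen_univ hF.smooth_U)
  have hpos : ∀ x, 0 < θ' x (F.T x) := fun x => hco x _ (by rw [(hF.θ_dual x).1]; exact one_pos)
  have hsb : ContMDiff (𝓡 3) 𝓘(ℝ, ℝ) ∞ (fun x => Real.sqrt (θ' x (F.T x))) := fun x =>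
    contMDiffAt_sqrt ((smoothForm_univ_iff.1 hJ'.smooth_form x).apply (hF.smoothAt_T x))
      (hpos x).ne'
  have hθ' : θ' = thetaB θ (fun x => Real.sqrt (θ' x (F.T x))) := by
    funext x
    ext v
    rw [thetaB_apply, Real.sq_sqrt (hpos x).le]
    conv_lhs => rw [hF.decomp v]
    rw [map_add, map_add, map_smul, map_smul, map_smul, (hJ'.ker_eq x _).1 (F.U x).2,
      (hJ'.ker_eq x _).1 (F.V x).2]
    simp [mul_comm]
  have hc : ∀ x, 0 < F.β x (J' x (F.U x)) := fun x => by
    have hU0 : F.U x ≠ 0 := fun h => by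
      have := (hF.α_dual x).2.1
      rw [h] at this
      simp at this
    -- With `b = √(θ'(T))` one has `dθ'(U, J'U) = b · b β(J'U)`, so positivity passes to `β(J'U)`.
    have h := hJ'.pos x (F.U x) hU0
    rw [hθ', hF.dForm_thetaB hsb, deform_α_apply, deform_β_apply, deform_α_apply, deform_β_apply,
      (hF.θ_dual x).2.1, (hF.α_dual x).2.1, (hF.β_dual x).2.1,
      (hF.ker_eq x _).1 (J' x (F.U x)).2] at h
    have hs := Real.sqrt_pos.2 (hpos x)
    simp only [mul_one, mul_zero, sub_zero, add_zero] at h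
    exact pos_of_mul_pos_right (pos_of_mul_pos_right h hs.le) hs.le
  refine ⟨fun x => (hF.smoothAt_α x).apply (hJU x), hsb, fun x => (hF.smoothAt_β x).apply (hJU x),
    hpos, hc, ?_, hθ'⟩
  funext x
  have hU : J' x (F.U x) = F.α x (J' x (F.U x)) • F.U x + F.β x (J' x (F.U x)) • F.V x :=
    hF.decomp_plane _
  have hV : J' x (F.V x) = -((1 + F.α x (J' x (F.U x)) ^ 2) / F.β x (J' x (F.U x))) • F.U x -
      F.α x (J' x (F.U x)) • F.V x := by
    -- Applying `J'` to `J'U = aU + cV` gives `-U = a J'U + c J'V`, which determines `J'V` because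
    -- `c ≠ 0`.
    have h2 := hJ'.J_sq x (F.U x)
    have hc := (hc x).ne'
    generalize F.α x (J' x (F.U x)) = a at *
    generalize F.β x (J' x (F.U x)) = c at *
    rw [hU, map_add, map_smul, map_smul, hU] at h2
    have h3 : c • J' x (F.V x) = -F.U x - a • (a • F.U x + c • F.V x) := by
      rw [← h2]; abel
    have h4 : J' x (F.V x) = c⁻¹ • (-F.U x - a • (a • F.U x + c • F.V x)) := by
      rw [← h3, smul_smul, inv_mul_cancel₀ hc, one_smul]
    rw [h4]
    match_scalars <;> field_simp
    ring
  refine LinearMap.ext fun v => ?_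
  rw [complexStructure_apply]
  conv_lhs => rw [hF.decomp_plane v]
  rw [map_add, map_smul, map_smul, hV]
  exact congrArg (fun z => F.α x v • z + _) hU

end IsContactFrame

/-! ### Smooth families and the flow equations -/

/-- The entry `-(1 + a²)/c` is differentiated by the quotient rule, so the derivatives of `a` and
`c` control the whole matrix. -/
lemma hasDerivWithinAt_complexStructure {E : Type*} [NormedAddCommGroup E] [NormedSpace ℝ E]
    {a c : ℝ → ℝ} {a' c' t : ℝ} {I : Set ℝ} (ha : HasDerivWithinAt a a' I t)
    (hc : HasDerivWithinAt c c' I t) (h0 : c t ≠ 0) (p q : ℝ) (u v : E) :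
    HasDerivWithinAt
      (fun s => p • (a s • u + c s • v) + q • (-((1 + a s ^ 2) / c s) • u - a s • v))
      (p • (a' • u + c' • v) +
        q • ((-(2 * a t * a' * c t - (1 + a t ^ 2) * c') / c t ^ 2) • u - a' • v)) I t := by
  have hq : HasDerivWithinAt (fun s => -((1 + a s ^ 2) / c s))
      (-(2 * a t * a' * c t - (1 + a t ^ 2) * c') / c t ^ 2) I t := by
    have h := (((ha.pow 2).const_add 1).div hc h0).neg
    refine h.congr_deriv ?_
    simp
    ring
  exact (((ha.smul_const u).add (hc.smul_const v)).const_smul p).add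
    (((hq.smul_const u).sub (ha.smul_const v)).const_smul q)

lemma SmoothFunFamily.slice {I : Set ℝ} {f : ℝ → M → ℝ} (hf : SmoothFunFamily I f) {t : ℝ}
    (ht : t ∈ I) : ContMDiff (𝓡 3) 𝓘(ℝ, ℝ) ∞ (f t) := by
  have h : ContMDiffOn (𝓡 3) (𝓘(ℝ, ℝ).prod (𝓡 3)) ∞ (fun x : M => ((t, x) : ℝ × M)) univ :=
    (contMDiff_const.prodMk contMDiff_id).contMDiffOn
  exact contMDiffOn_univ.1 (ContMDiffOn.comp (g := fun p : ℝ × M => f p.1 p.2)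
    (t := I ×ˢ univ) hf h fun x _ => ⟨ht, mem_univ x⟩)

lemma SmoothFunFamily.of_contMDiff {I : Set ℝ} {f : M → ℝ} (hf : ContMDiff (𝓡 3) 𝓘(ℝ, ℝ) ∞ f) :
    SmoothFunFamily I fun _ => f :=
  (hf.comp contMDiff_snd).contMDiffOn

lemma SmoothFunFamily.add {I : Set ℝ} {f g : ℝ → M → ℝ} (hf : SmoothFunFamily I f)
    (hg : SmoothFunFamily I g) : SmoothFunFamily I fun t x => f t x + g t x :=
  ContMDiffOn.add hf hg

lemma SmoothFunFamily.mul {I : Set ℝ} {f g : ℝ → M → ℝ} (hf : SmoothFunFamily I f)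
    (hg : SmoothFunFamily I g) : SmoothFunFamily I fun t x => f t x * g t x :=
  ContMDiffOn.mul hf hg

lemma SmoothFunFamily.neg {I : Set ℝ} {f : ℝ → M → ℝ} (hf : SmoothFunFamily I f) :
    SmoothFunFamily I fun t x => -f t x :=
  ContMDiffOn.neg hf

lemma SmoothFunFamily.inv {I : Set ℝ} {f : ℝ → M → ℝ} (hf : SmoothFunFamily I f)
    (h0 : ∀ t ∈ I, ∀ x, f t x ≠ 0) : SmoothFunFamily I fun t x => (f t x)⁻¹ :=
  fun p hp => (contDiffAt_inv ℝ (h0 p.1 hp.1 p.2)).contMDiffAt.comp_contMDiffWithinAt p (hf p hp)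

lemma SmoothFunFamily.sqrt {I : Set ℝ} {f : ℝ → M → ℝ} (hf : SmoothFunFamily I f)
    (h0 : ∀ t ∈ I, ∀ x, f t x ≠ 0) : SmoothFunFamily I fun t x => Real.sqrt (f t x) :=
  fun p hp => (Real.contDiffAt_sqrt (h0 p.1 hp.1 p.2)).contMDiffAt.comp_contMDiffWithinAt p
    (hf p hp)

lemma SmoothFunFamily.congr {I : Set ℝ} {f g : ℝ → M → ℝ} (hf : SmoothFunFamily I f)
    (h : ∀ t ∈ I, ∀ x, g t x = f t x) : SmoothFunFamily I g :=
  ContMDiffOn.congr hf fun p hp => h p.1 hp.1 p.2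

lemma IsTorsionFlow.congr [IsManifold (𝓡 3) ∞ M] {ξ : PlaneField M} {I : Set ℝ}
    {J J' : ℝ → PlaneEndo ξ} {θ θ' : ℝ → OneForm M ℝ} (hJ : ∀ t ∈ I, J t = J' t)
    (hθ : ∀ t ∈ I, θ t = θ' t) (h : IsTorsionFlow ξ I J θ) : IsTorsionFlow ξ I J' θ' := by
  intro t ht x
  obtain ⟨h1, h2⟩ := h t ht x
  rw [← hJ t ht, ← hθ t ht]
  exact ⟨fun v => HasDerivWithinAt.congr_of_mem (F := E3)
      (f := fun s => (J s x v : TangentSpace (𝓡 3) x)) (h1 v) (fun s hs =>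
        congrArg (fun K : PlaneEndo ξ => (K x v : TangentSpace (𝓡 3) x)) (hJ s hs).symm) ht,
    fun v => (h2 v).congr_of_mem (fun s hs => by rw [hθ s hs]) ht⟩

namespace IsContactFrame

variable [IsManifold (𝓡 3) ∞ M] {ξ : PlaneField M} {θ : OneForm M ℝ} {F : Frame ξ}
  (hF : IsContactFrame θ F)

include hF

/-- The frame `F` is fixed in time, so at each `x` the flow is a statement about curves in fixed
vector spaces. One direction reads off `a` and `c` by applying `α` and `β` to `∂ₜ(JU)`; in the
other, the second column of `J` has the right derivative by the form of `torsionW`. The equation for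
`θ` is equivalent to its value on `T`, as both sides are multiples of `θ`. -/
lemma isTorsionFlow_iff {I : Set ℝ} {a b c : ℝ → M → ℝ} (ha : SmoothFunFamily I a)
    (hb : SmoothFunFamily I b) (hc : SmoothFunFamily I c)
    (h0 : ∀ t ∈ I, ∀ x, 0 < b t x ∧ 0 < c t x) :
    IsTorsionFlow ξ I (fun t => Jabc F θ (a t) (b t) (c t)) (fun t => thetaB θ (b t)) ↔
      SolvesSystem F θ I a b c := by
  refine forall_congr' fun t => forall_congr' fun ht => forall_congr' fun x => ?_
  have hJ : ∀ s ∈ I, ∀ x, Jabc F θ (a s) (b s) (c s) x = F.complexStructure (a s) (c s) x :=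
    fun s hs x => hF.deform_complexStructure _ _ (h0 s hs x).1.ne'
  have htor : torsionTensor ξ (Jabc F θ (a t) (b t) (c t)) (thetaB θ (b t)) x =
      F.torsionEndo (A11abc F θ (a t) (b t) (c t)) (a t) (c t) x :=
    (congrFun ((hF.deform (hb.slice ht) fun x => (h0 t ht x).1).torsionTensor_complexStructure
      (ha.slice ht) (hc.slice ht) fun x => (h0 t ht x).2) x).trans
        (hF.deform_torsionEndo _ _ _ (h0 t ht x).1.ne')
  set A := A11abc F θ (a t) (b t) (c t) x with hA
  have hsys : (-2 * (A.re * (-2 * a t x * c t x / (a t x ^ 2 + 1)) +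
      A.im * ((1 - a t x ^ 2) * c t x / (a t x ^ 2 + 1)))) = 2 * torsionV A (a t x) (c t x) := by
    rw [torsionV]; ring
  rw [← and_assoc]
  refine and_congr ?_ ?_
  · rw [hsys]
    constructor
    · intro h
      have hU := h (F.U x)
      rw [htor] at hU
      have comp : ∀ η : TangentSpace (𝓡 3) x →L[ℝ] ℝ, HasDerivWithinAt
          (fun s => η (Jabc F θ (a s) (b s) (c s) x (F.U x)))
          (η ((2 : ℝ) • (F.torsionEndo (A11abc F θ (a t) (b t) (c t)) (a t) (c t) x (F.U x) :
            TangentSpace (𝓡 3) x))) I t := fun η =>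
        HasFDerivAt.comp_hasDerivWithinAt (F := E3) t
          (ContinuousLinearMap.hasFDerivAt (E := E3) η) hU
      constructor
      · have h1 := comp (F.α x)
        rw [map_smul, torsionEndo_apply] at h1
        simp only [Submodule.coe_add, Submodule.coe_sub, Submodule.coe_smul, map_add, map_sub,
          map_smul, hF.α_dual x, hF.β_dual x, smul_eq_mul, mul_one, mul_zero, add_zero, zero_mul,
          one_mul] at h1
        refine h1.congr_of_mem (fun s hs => ?_) ht
        rw [hJ s hs, hF.α_complexStructure, (hF.α_dual x).2.1, (hF.β_dual x).2.1]
        ring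
      · have h1 := comp (F.β x)
        rw [map_smul, torsionEndo_apply] at h1
        simp only [Submodule.coe_add, Submodule.coe_sub, Submodule.coe_smul, map_add, map_sub,
          map_smul, hF.α_dual x, hF.β_dual x, smul_eq_mul, mul_one, mul_zero, add_zero, zero_mul,
          one_mul, zero_add] at h1
        refine h1.congr_of_mem (fun s hs => ?_) ht
        rw [hJ s hs, hF.β_complexStructure, (hF.α_dual x).2.1, (hF.β_dual x).2.1]
        ring
    · rintro ⟨h1, h2⟩ v
      have h3 := hasDerivWithinAt_complexStructure (E := E3) h1 h2 (h0 t ht x).2.ne'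
        (F.α x v) (F.β x v) (F.U x : TangentSpace (𝓡 3) x) (F.V x : TangentSpace (𝓡 3) x)
      rw [htor]
      refine HasDerivWithinAt.congr_of_mem (F := E3) (h3.congr_deriv ?_) (fun s hs => ?_) ht
      · rw [torsionEndo_apply]
        simp only [Submodule.coe_add, Submodule.coe_sub, Submodule.coe_smul]
        have key : ∀ u v' : TangentSpace (𝓡 3) x, ∀ p q : ℝ,
            p • ((2 * (A.re + a t x * A.im)) • u + (2 * torsionV A (a t x) (c t x)) • v') +
              q • ((-(2 * a t x * (2 * (A.re + a t x * A.im)) * c t x -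
                (1 + a t x ^ 2) * (2 * torsionV A (a t x) (c t x))) / c t x ^ 2) • u -
                (2 * (A.re + a t x * A.im)) • v') =
            (2 : ℝ) • (p • (torsionU A (a t x) • u + torsionV A (a t x) (c t x) • v') +
              q • (torsionW A (a t x) (c t x) • u - torsionU A (a t x) • v')) := by
          intro u v' p q
          simp only [torsionW, torsionU]
          match_scalars <;> ring
        exact key _ _ _ _
      · have h4 : (Jabc F θ (a s) (b s) (c s) x v : TangentSpace (𝓡 3) x) =
            F.complexStructure (a s) (c s) x v :=
          congrArg (fun K : ξ x →ₗ[ℝ] ξ x => (K v : TangentSpace (𝓡 3) x)) (hJ s hs x)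
        refine h4.trans ?_
        rw [complexStructure_apply]
        rfl
  · constructor
    · intro h
      have h1 := h (F.T x)
      simp only [thetaB_apply, (hF.θ_dual x).1, mul_one] at h1
      exact h1
    · intro h v
      simp only [thetaB_apply]
      exact (h.mul_const (θ x v)).congr_deriv (by rw [Wabc]; ring)

lemma isSmoothFamily {I : Set ℝ} {a b c : ℝ → M → ℝ} (ha : SmoothFunFamily I a)
    (hb : SmoothFunFamily I b) (hc : SmoothFunFamily I c)
    (h0 : ∀ t ∈ I, ∀ x, 0 < b t x ∧ 0 < c t x) :
    IsSmoothFamily ξ I (fun t => Jabc F θ (a t) (b t) (c t)) (fun t => thetaB θ (b t)) where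
  pseudohermitian t ht := (hF.deform (hb.slice ht) fun x => (h0 t ht x).1).isPseudohermitian
    (ha.slice ht) (hc.slice ht) fun x => (h0 t ht x).2
  smooth_form X hX := by
    have h : SmoothFunFamily I fun _ x => θ x (X x) := .of_contMDiff fun x =>
      (hF.smoothAt_θ x).apply (smoothVField_univ_iff.1 hX x)
    exact ((hb.mul hb).mul h).congr fun t _ x => by rw [thetaB_apply, pow_two]
  smooth_J X η hX hη := by
    have hX' := smoothVField_univ_iff.1 hX
    have hη' := smoothForm_univ_iff.1 hη
    have hα : SmoothFunFamily I fun _ x => F.α x (X x) := .of_contMDiff fun x =>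
      (hF.smoothAt_α x).apply (hX' x)
    have hβ : SmoothFunFamily I fun _ x => F.β x (X x) := .of_contMDiff fun x =>
      (hF.smoothAt_β x).apply (hX' x)
    have hU : SmoothFunFamily I fun _ x => η x (F.U x) := .of_contMDiff fun x =>
      (hη' x).apply (hF.smoothAt_U x)
    have hV : SmoothFunFamily I fun _ x => η x (F.V x) := .of_contMDiff fun x =>
      (hη' x).apply (hF.smoothAt_V x)
    have h1 : SmoothFunFamily I fun _ (_ : M) => (1 : ℝ) := .of_contMDiff contMDiff_const
    have hq := ((h1.add (ha.mul ha)).mul (hc.inv fun t ht x => (h0 t ht x).2.ne')).neg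
    refine ((hα.mul ((ha.mul hU).add (hc.mul hV))).add
      (hβ.mul ((hq.mul hU).add (ha.mul hV).neg))).congr fun t ht x => ?_
    rw [show Jabc F θ (a t) (b t) (c t) x = _ from
      hF.deform_complexStructure _ _ (h0 t ht x).1.ne', complexStructure_apply]
    simp only [Submodule.coe_add, Submodule.coe_sub, Submodule.coe_smul, map_add, map_sub,
      map_smul, smul_eq_mul]
    ring

end IsContactFrame

/-! ### A global section from the vanishing Chern class -/

/-- The sheaf of smooth functions has no first cohomology: with a subordinate partition of unity, `h
i = ∑ ρ k · g i k` works by the cocycle identity and `∑ ρ k = 1`. Each summand is smooth on `U i`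
because the closed support of `ρ k` lies in `U k`. -/
lemma exists_splitting_of_cocycle [IsManifold (𝓡 3) ∞ M] [T2Space M] [SigmaCompactSpace M]
    (𝒱 : OpenCover M) {g : 𝒱.ι → 𝒱.ι → M → ℂ}
    (hg : ∀ i j, ContMDiffOn (𝓡 3) 𝓘(ℝ, ℂ) ∞ (g i j) (𝒱.U i ∩ 𝒱.U j))
    (hcocycle : ∀ i j k, ∀ x ∈ 𝒱.U i ∩ 𝒱.U j ∩ 𝒱.U k, g j k x - g i k x + g i j x = 0) :
    ∃ h : 𝒱.ι → M → ℂ, (∀ i, ∀ x ∈ 𝒱.U i, ContMDiffAt (𝓡 3) 𝓘(ℝ, ℂ) ∞ (h i) x) ∧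
      ∀ i j, ∀ x ∈ 𝒱.U i ∩ 𝒱.U j, h i x - h j x = g i j x := by
  obtain ⟨ρ, hρ⟩ := SmoothPartitionOfUnity.exists_isSubordinate (𝓡 3) (isClosed_univ (X := M))
    𝒱.U 𝒱.isOpen fun x _ => mem_iUnion.2 (𝒱.covers x)
  refine ⟨fun i x => ∑ᶠ k, ρ k x • g i k x, fun i x hx => ?_, ?_⟩
  · refine ρ.contMDiffAt_finsum fun k hk => ?_
    have hxk : x ∈ 𝒱.U i ∩ 𝒱.U k := ⟨hx, hρ k hk⟩
    exact (hg i k x hxk).contMDiffAt (((𝒱.isOpen i).inter (𝒱.isOpen k)).mem_nhds hxk)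
  · rintro i j x ⟨hi, hj⟩
    have hfin : ∀ f : 𝒱.ι → ℂ, (Function.support fun k => ρ k x • f k).Finite := fun f =>
      (ρ.locallyFinite.point_finite x).subset fun k hk => by
        simp only [Function.mem_support, ne_eq, smul_eq_zero, not_or] at hk
        exact hk.1
    have h1 : ∀ k, ρ k x • g i k x - ρ k x • g j k x = ρ k x • g i j x := by
      intro k
      rw [← smul_sub]
      by_cases hk : ρ k x = 0
      · rw [hk, zero_smul, zero_smul]
      · have hkx : x ∈ 𝒱.U k := hρ k (subset_tsupport _ hk)
        congr 1
        linear_combination -hcocycle i j k x ⟨⟨hi, hj⟩, hkx⟩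
    rw [← finsum_sub_distrib (hfin _) (hfin _), finsum_congr h1, ← finsum_smul,
      ρ.sum_eq_one (mem_univ x), one_smul]

lemma contMDiffAt_intCast {m : M → ℤ} {O : Set M} (hm : ContinuousOn m O) (hO : IsOpen O) {x : M}
    (hx : x ∈ O) : ContMDiffAt (𝓡 3) 𝓘(ℝ, ℂ) ∞ (fun y => (m y : ℂ)) x := by
  have h : ∀ᶠ y in 𝓝 x, m y = m x :=
    (hm.continuousAt (hO.mem_nhds hx)).eventually (mem_nhds_discrete.2 (mem_singleton (m x)))
  exact (contMDiffAt_const (c := (m x : ℂ))).congr_of_eventuallyEq (h.mono fun y hy => by simp [hy])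

section

variable {ξ : PlaneField M} {J : PlaneEndo ξ}

lemma cmul_cmul {x : M} (hJ : ∀ v : ξ x, J x (J x v) = -v) (z w : ℂ) (v : ξ x) :
    cmul J x z (cmul J x w v) = cmul J x (z * w) v := by
  simp only [cmul, map_add, map_smul, hJ, Complex.mul_re, Complex.mul_im]
  module

lemma cmul_one (x : M) (v : ξ x) : cmul J x 1 v = v := by
  simp [cmul]

lemma cmul_ne_zero {x : M} (hJ : ∀ v : ξ x, J x (J x v) = -v) {z : ℂ} (hz : z ≠ 0) {v : ξ x}
    (hv : v ≠ 0) : cmul J x z v ≠ 0 := by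
  intro h
  apply hv
  have h1 := cmul_cmul hJ z⁻¹ z v
  rw [h, inv_mul_cancel₀ hz, cmul_one] at h1
  rw [← h1]
  simp [cmul]

/-- Subtracting the integers `m` from the logarithms `f` makes them an additive cocycle without
changing their exponentials. If `h` splits `f - m`, the rescaled sections `exp(2πi h i) s i` agree
on overlaps. -/
lemma exists_global_section [IsManifold (𝓡 3) ∞ M] [T2Space M] [SigmaCompactSpace M]
    {θ : OneForm M ℝ} (hJθ : IsPseudohermitian ξ J θ) (hc₁ : FirstChernClassEqZero J) :
    ∃ S : ∀ x, ξ x, SmoothVField (fun x => (S x : TangentSpace (𝓡 3) x)) univ ∧ ∀ x, S x ≠ 0 := by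
  obtain ⟨𝒰, C, ⟨s, f, hs, hs0, hf, hsf, hCf⟩, 𝒱, r, m, hr, hm, hCm⟩ := hc₁
  obtain ⟨h, hh, hsplit⟩ := exists_splitting_of_cocycle 𝒱
    (g := fun i j x => f (r i) (r j) x - m i j x)
    (fun i j x hx => (((hf (r i) (r j)).contMDiffAt
      ((((𝒰.isOpen _).inter (𝒰.isOpen _)).mem_nhds ⟨hr i hx.1, hr j hx.2⟩))).sub
        (contMDiffAt_intCast (hm i j) ((𝒱.isOpen i).inter (𝒱.isOpen j)) hx)).contMDiffWithinAt)
    (fun i j k x hx => by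
      have h1 := hCf (r i) (r j) (r k) x ⟨⟨hr i hx.1.1, hr j hx.1.2⟩, hr k hx.2⟩
      have h2 := congrArg (fun n : ℤ => (n : ℂ)) (hCm i j k x hx)
      push_cast at h2
      linear_combination h2 - h1)
  let e : 𝒱.ι → M → ℂ := fun i x => Complex.exp (2 * Real.pi * Complex.I * h i x)
  let σ : 𝒱.ι → ∀ x, ξ x := fun i x => cmul J x (e i x) (s (r i) x)
  have hσ : ∀ i j, ∀ x ∈ 𝒱.U i ∩ 𝒱.U j, σ i x = σ j x := by
    intro i j x hx
    simp only [σ, e]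
    rw [hsf (r i) (r j) x ⟨hr i hx.1, hr j hx.2⟩, cmul_cmul (hJθ.J_sq x), ← Complex.exp_add]
    congr 1
    rw [Complex.exp_eq_exp_iff_exists_int]
    -- Since `h i - h j = f - m`, the two exponents differ by `-2πi m`.
    refine ⟨-m i j x, ?_⟩
    push_cast
    linear_combination (2 * Real.pi * Complex.I) * hsplit i j x hx
  -- The index may jump from point to point; agreement on overlaps allows it to be frozen near `x`
  -- for the proof of smoothness.
  choose i hi using 𝒱.covers
  refine ⟨fun x => σ (i x) x, smoothVField_univ_iff.2 fun x => ?_, fun x =>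
    cmul_ne_zero (hJθ.J_sq x) (Complex.exp_ne_zero _) (hs0 _ x (hr _ (hi x)))⟩
  have he : ContMDiffAt (𝓡 3) 𝓘(ℝ, ℂ) ∞ (e (i x)) x :=
    (Complex.contDiff_exp (n := ∞) (𝕜 := ℝ)).contMDiff.contMDiffAt.comp x
      (ContMDiffAt.complex_mul contMDiffAt_const (hh (i x) x (hi x)))
  have hU : x ∈ 𝒰.U (r (i x)) := hr _ (hi x)
  have h1 := (SmoothVFieldAt.smul (contMDiffAt_re he) ((hs (r (i x))).at (𝒰.isOpen _) hU)).add
    (.smul (contMDiffAt_im he)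
      ((hJθ.smooth_J _ _ (𝒰.isOpen _) (hs (r (i x)))).at (𝒰.isOpen _) hU))
  refine h1.congr ?_
  filter_upwards [(𝒱.isOpen (i x)).mem_nhds (hi x)] with y hy
  rw [hσ (i y) (i x) y ⟨hi y, hy⟩]
  rfl

end

/-! ### The symplectic frame of a non-vanishing section -/

/-- Dual functionals make the three vectors independent, hence a basis in dimension three, and then
read off the coefficients. -/
lemma eq_dual_combination {E : Type*} [AddCommGroup E] [Module ℝ E] (hE : Module.finrank ℝ E = 3)
    {θ α β : E →ₗ[ℝ] ℝ} {T U V : E} (hθ : θ T = 1 ∧ θ U = 0 ∧ θ V = 0)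
    (hα : α T = 0 ∧ α U = 1 ∧ α V = 0) (hβ : β T = 0 ∧ β U = 0 ∧ β V = 1) (v : E) :
    v = θ v • T + α v • U + β v • V := by
  have hli : LinearIndependent ℝ ![T, U, V] := by
    rw [Fintype.linearIndependent_iff]
    intro g hg
    simp only [Fin.sum_univ_three, Matrix.cons_val] at hg
    intro i
    fin_cases i
    · simpa [hθ] using congrArg θ hg
    · simpa [hα] using congrArg α hg
    · simpa [hβ] using congrArg β hg
  have : FiniteDimensional ℝ E := Module.finite_of_finrank_pos (by omega)
  have hspan := hli.span_eq_top_of_card_eq_finrank' (by simp [hE])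
  have hv : v ∈ Submodule.span ℝ (Set.range ![T, U, V]) := hspan ▸ Submodule.mem_top
  obtain ⟨g, rfl⟩ := (Submodule.mem_span_range_iff_exists_fun ℝ).1 hv
  simp [Fin.sum_univ_three, hθ, hα, hβ]

section

variable [IsManifold (𝓡 3) ∞ M]

/-- Cartan's formula at all nearby points replaces the varying charts by terms that are visibly
smooth; this is why the fields must be smooth near `x`. -/
lemma contMDiffAt_dForm {G : Type} [NormedAddCommGroup G] [NormedSpace ℝ G] {η : OneForm M G}
    {X Y : VField M} {x : M} (hη : ∀ y, SmoothFormAt η y) (hX : ∀ᶠ y in 𝓝 x, SmoothVFieldAt X y)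
    (hY : ∀ᶠ y in 𝓝 x, SmoothVFieldAt Y y) :
    ContMDiffAt (𝓡 3) 𝓘(ℝ, G) ∞ (fun y => dForm η y (X y) (Y y)) x := by
  have hX0 := hX.self_of_nhds
  have hY0 := hY.self_of_nhds
  refine ContMDiffAt.congr_of_eventuallyEq ((((smoothFormAt_differential
    ((hη x).apply hY0)).apply hX0).sub ((smoothFormAt_differential ((hη x).apply hX0)).apply
      hY0)).sub ((hη x).apply (hX0.bracket hY0))) ?_
  filter_upwards [hX, hY] with y hXy hYy
  exact dForm_apply (hη y) hXy hYy

end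

/-- The contraction `w ↦ dη (w, Y)`. -/
def contractRight (η : OneForm M ℝ) (Y : VField M) : OneForm M ℝ := fun x =>
  let L : E3 →ₗ[ℝ] ℝ :=
    { toFun := fun w => dForm η x w (Y x)
      map_add' := fun v w => dForm_add_left η x v w (Y x)
      map_smul' := fun r w => dForm_smul_left η x r w (Y x) }
  (LinearMap.toContinuousLinearMap L : E3 →L[ℝ] ℝ)

lemma smoothFormAt_contractRight [IsManifold (𝓡 3) ∞ M] {η : OneForm M ℝ} {Y : VField M}
    (hη : ∀ y, SmoothFormAt η y) (hY : ∀ y, SmoothVFieldAt Y y) (x : M) :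
    SmoothFormAt (contractRight η Y) x :=
  smoothFormAt_of_eventually_apply fun _ hX => contMDiffAt_dForm hη hX (.of_forall hY)

/-- Dividing `JS` by the positive function `dθ(S, JS)` gives `dθ(U, V) = 1`, so `dθ(·, V)` and
`dθ(U, ·)` are dual to `U, V` on `ξ`. The Reeb field is any vector transverse to `ξ`, stripped of
its `U` and `V` components and normalized. -/
lemma exists_isContactFrame [IsManifold (𝓡 3) ∞ M] {ξ : PlaneField M} {J : PlaneEndo ξ}
    {θ : OneForm M ℝ} (hJθ : IsPseudohermitian ξ J θ) {S : ∀ x, ξ x}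
    (hS : SmoothVField (fun x => (S x : TangentSpace (𝓡 3) x)) univ) (hS0 : ∀ x, S x ≠ 0) :
    ∃ F : Frame ξ, IsContactFrame θ F := by
  have hθ := smoothForm_univ_iff.1 hJθ.smooth_form
  have hU := smoothVField_univ_iff.1 hS
  have hJS := smoothVField_univ_iff.1 (hJθ.smooth_J univ S isOpen_univ hS)
  let d : M → ℝ := fun x => dForm θ x (S x) (J x (S x))
  have hd0 : ∀ x, d x ≠ 0 := fun x => (hJθ.pos x _ (hS0 x)).ne'
  have hd : ∀ x, ContMDiffAt (𝓡 3) 𝓘(ℝ, ℝ) ∞ d x := fun x =>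
    contMDiffAt_dForm hθ (.of_forall hU) (.of_forall hJS)
  let W : ∀ x, ξ x := fun x => (1 / d x) • J x (S x)
  let U : VField M := fun x => (S x : TangentSpace (𝓡 3) x)
  let V : VField M := fun x => (W x : TangentSpace (𝓡 3) x)
  have hV : ∀ x, SmoothVFieldAt V x := fun x =>
    .smul (contMDiffAt_div contMDiffAt_const (hd x) (hd0 x)) (hJS x)
  have hUV : ∀ x, dForm θ x (U x) (V x) = 1 := fun x => by
    have h := dForm_smul_right θ x (1 / d x) (U x) (J x (S x))
    exact h.trans (one_div_mul_cancel (hd0 x))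
  have hθU : ∀ x, θ x (U x) = 0 := fun x => (hJθ.ker_eq x _).1 (S x).2
  have hθV : ∀ x, θ x (V x) = 0 := fun x => (hJθ.ker_eq x _).1 (W x).2
  let α := contractRight θ V
  let β : OneForm M ℝ := fun x => -contractRight θ U x
  have hα : ∀ x w, α x w = dForm θ x w (V x) := fun _ _ => rfl
  have hβ : ∀ x w, β x w = dForm θ x (U x) w := fun x w => (dForm_swap θ x (U x) w).symm
  have hαs : ∀ x, SmoothFormAt α x := smoothFormAt_contractRight hθ hV
  have hβs : ∀ x, SmoothFormAt β x := fun x => smoothFormAt_of_apply fun X hX =>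
    ((smoothFormAt_contractRight hθ hU x).apply hX).neg
  let R : ∀ x, TangentSpace (𝓡 3) x → TangentSpace (𝓡 3) x := fun x N =>
    (1 / θ x N) • (N - α x N • U x - β x N • V x)
  have hαUV : ∀ x, α x (U x) = 1 ∧ α x (V x) = 0 := fun x =>
    ⟨(hα x _).trans (hUV x), (hα x _).trans (dForm_self _ _ _)⟩
  have hβUV : ∀ x, β x (U x) = 0 ∧ β x (V x) = 1 := fun x =>
    ⟨(hβ x _).trans (dForm_self _ _ _), (hβ x _).trans (hUV x)⟩
  have hR : ∀ x N, θ x N ≠ 0 → θ x (R x N) = 1 ∧ α x (R x N) = 0 ∧ β x (R x N) = 0 := by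
    intro x N hN
    simp only [R, map_smul, map_sub, hαUV, hβUV, hθU, hθV, smul_eq_mul]
    refine ⟨?_, ?_, ?_⟩
    · field_simp
      ring
    · ring
    · ring
  have hN : ∀ x, ∃ N, θ x N ≠ 0 := by
    intro x
    obtain ⟨u, v, w, h⟩ := hJθ.contact x
    by_contra! h0
    exact h (by simp [h0])
  choose N hN using hN
  let T : VField M := fun x => R x (N x)
  have hT : ∀ x, θ x (T x) = 1 ∧ α x (T x) = 0 ∧ β x (T x) = 0 := fun x => hR x _ (hN x)
  have hfin : ∀ x : M, Module.finrank ℝ (TangentSpace (𝓡 3) x) = 3 := fun x =>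
    finrank_euclideanSpace_fin (𝕜 := ℝ) (n := 3)
  have hdec : ∀ x v, v = θ x v • T x + α x v • U x + β x v • V x := fun x v =>
    eq_dual_combination (hfin x) (θ := (θ x : TangentSpace (𝓡 3) x →ₗ[ℝ] ℝ)) (α := α x)
      (β := β x) ⟨(hT x).1, hθU x, hθV x⟩ ⟨(hT x).2.1, hαUV x⟩ ⟨(hT x).2.2, hβUV x⟩ v
  -- The result of the normalization does not depend on the transverse vector, so near a point the
  -- arbitrary choice `N` can be replaced by a smooth field.
  have hTR : ∀ x n, θ x n ≠ 0 → T x = R x n := fun x n hn => by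
    have h := hdec x (R x n)
    rw [(hR x n hn).1, (hR x n hn).2.1, (hR x n hn).2.2] at h
    rw [h]
    simp
  have hTs : ∀ x, SmoothVFieldAt T x := by
    intro x
    obtain ⟨n, hn, hns⟩ := exists_smoothVFieldAt (N x)
    have h0 : θ x (n x) ≠ 0 := hn ▸ hN x
    have hθn := (hθ x).apply hns
    refine SmoothVFieldAt.congr (.smul
      (contMDiffAt_div (contMDiffAt_const (c := (1 : ℝ))) hθn h0)
      ((hns.sub (.smul ((hαs x).apply hns) (hU x))).sub (.smul ((hβs x).apply hns) (hV x)))) ?_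
    filter_upwards [hθn.continuousAt.eventually_ne h0] with y hy
    exact hTR y _ hy
  have hdθ : ∀ x v w, dForm θ x v w = α x v * β x w - α x w * β x v := by
    intro x v w
    -- By the definition of `α` and `β` as contractions, `α(T) = β(T) = 0` means that `dθ(T, ·)`
    -- vanishes on `V` and `U`.
    have hTU : dForm θ x (T x) (U x) = 0 := by
      rw [dForm_swap, ← hβ, (hT x).2.2, neg_zero]
    have hTV : dForm θ x (T x) (V x) = 0 := (hα x _).symm.trans (hT x).2.1
    conv_lhs => rw [hdec x v, hdec x w]
    simp only [dForm_add_left, dForm_add_right, dForm_smul_left, dForm_smul_right, dForm_self, hTU,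
      hTV, hUV, dForm_swap θ x (U x) (T x), dForm_swap θ x (V x) (T x),
      dForm_swap θ x (V x) (U x), smul_eq_mul]
    ring
  refine ⟨⟨T, S, W, α, β⟩,
    { smooth_T := smoothVField_univ_iff.2 hTs
      smooth_U := hS
      smooth_V := smoothVField_univ_iff.2 hV
      smooth_α := smoothForm_univ_iff.2 hαs
      smooth_β := smoothForm_univ_iff.2 hβs
      reeb := fun x => ⟨(hT x).1, fun w => ?_⟩
      basis := fun x => coframe_basis_of_dual ⟨(hT x).1, hθU x, hθV x⟩ ⟨(hT x).2.1, hαUV x⟩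
        ⟨(hT x).2.2, hβUV x⟩ (hdec x)
      θ_dual := fun x => ⟨(hT x).1, hθU x, hθV x⟩
      α_dual := fun x => ⟨(hT x).2.1, hαUV x⟩
      β_dual := fun x => ⟨(hT x).2.2, hβUV x⟩
      d_theta := hdθ
      smooth_θ := hJθ.smooth_form
      ker_eq := hJθ.ker_eq }⟩
  show dForm θ x (T x) w = 0
  rw [hdθ, (hT x).2.1, (hT x).2.2, zero_mul, mul_zero, sub_zero]

/-! ### The functions `a`, `b`, `c` of a structure and of a family -/

namespace IsContactFrame

variable [IsManifold (𝓡 3) ∞ M] {ξ : PlaneField M} {θ : OneForm M ℝ} {F : Frame ξ}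
  (hF : IsContactFrame θ F)

include hF

lemma Jabc_eq {a b c : M → ℝ} (hb : ∀ x, 0 < b x) :
    Jabc F θ a b c = F.complexStructure a c :=
  funext fun x => hF.deform_complexStructure a c (hb x).ne'

lemma existsUnique_functions {J' : PlaneEndo ξ} {θ' : OneForm M ℝ}
    (hJ' : IsPseudohermitian ξ J' θ') (hco : SameCoorientation θ θ') :
    ∃! p : (M → ℝ) × (M → ℝ) × (M → ℝ),
      ContMDiff (𝓡 3) 𝓘(ℝ, ℝ) ∞ p.1 ∧ ContMDiff (𝓡 3) 𝓘(ℝ, ℝ) ∞ p.2.1 ∧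
      ContMDiff (𝓡 3) 𝓘(ℝ, ℝ) ∞ p.2.2 ∧ (∀ x, 0 < p.2.1 x) ∧ (∀ x, 0 < p.2.2 x) ∧
      J' = Jabc F θ p.1 p.2.1 p.2.2 ∧ θ' = thetaB θ p.2.1 := by
  obtain ⟨ha, hb, hc, hb0, hc0, hJ, hθ⟩ := hF.classification hJ' hco
  have hb0' : ∀ x, 0 < Real.sqrt (θ' x (F.T x)) := fun x => Real.sqrt_pos.2 (hb0 x)
  refine ⟨(fun x => F.α x (J' x (F.U x)), fun x => Real.sqrt (θ' x (F.T x)),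
    fun x => F.β x (J' x (F.U x))), ⟨ha, hb, hc, hb0', hc0, hJ.trans (hF.Jabc_eq hb0').symm, hθ⟩, ?_⟩
  -- Any representing triple is recovered as `α(J'U)`, `√(θ'(T))`, `β(J'U)`; the sign of `b` selects
  -- the root.
  rintro ⟨a, b, c⟩ ⟨-, -, -, hb0'', -, rfl, rfl⟩
  refine Prod.ext (funext fun x => ?_) (Prod.ext (funext fun x => ?_) (funext fun x => ?_))
  · simp only [hF.Jabc_eq hb0'', hF.α_complexStructure, hF.α_dual x, hF.β_dual x]
    ring
  · simp only [thetaB_apply, hF.θ_dual x, mul_one]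
    exact (Real.sqrt_sq (hb0'' x).le).symm
  · simp only [hF.Jabc_eq hb0'', hF.β_complexStructure, hF.α_dual x, hF.β_dual x]
    ring

lemma exists_functions {I : Set ℝ} {Jt : ℝ → PlaneEndo ξ} {θt : ℝ → OneForm M ℝ}
    (hfam : IsSmoothFamily ξ I Jt θt) (hco : ∀ t ∈ I, SameCoorientation θ (θt t)) :
    ∃ a b c : ℝ → M → ℝ, SmoothFunFamily I a ∧ SmoothFunFamily I b ∧ SmoothFunFamily I c ∧
      (∀ t ∈ I, ∀ x, 0 < b t x ∧ 0 < c t x) ∧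
      (∀ t ∈ I, Jt t = Jabc F θ (a t) (b t) (c t) ∧ θt t = thetaB θ (b t)) ∧
      (IsTorsionFlow ξ I Jt θt ↔ SolvesSystem F θ I a b c) := by
  let a : ℝ → M → ℝ := fun t x => F.α x (Jt t x (F.U x))
  let b : ℝ → M → ℝ := fun t x => Real.sqrt (θt t x (F.T x))
  let c : ℝ → M → ℝ := fun t x => F.β x (Jt t x (F.U x))
  have hcl := fun t ht => hF.classification (hfam.pseudohermitian t ht) (hco t ht)
  have ha : SmoothFunFamily I a := hfam.smooth_J F.U F.α hF.smooth_U hF.smooth_α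
  have hc : SmoothFunFamily I c := hfam.smooth_J F.U F.β hF.smooth_U hF.smooth_β
  have hb : SmoothFunFamily I b := (hfam.smooth_form F.T hF.smooth_T).sqrt fun t ht x =>
    ((hcl t ht).2.2.2.1 x).ne'
  have h0 : ∀ t ∈ I, ∀ x, 0 < b t x ∧ 0 < c t x := fun t ht x =>
    ⟨Real.sqrt_pos.2 ((hcl t ht).2.2.2.1 x), (hcl t ht).2.2.2.2.1 x⟩
  have hJ : ∀ t ∈ I, Jt t = Jabc F θ (a t) (b t) (c t) := fun t ht =>
    (hcl t ht).2.2.2.2.2.1.trans (hF.Jabc_eq fun x => (h0 t ht x).1).symm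
  have hθ : ∀ t ∈ I, θt t = thetaB θ (b t) := fun t ht => (hcl t ht).2.2.2.2.2.2
  refine ⟨a, b, c, ha, hb, hc, h0, fun t ht => ⟨hJ t ht, hθ t ht⟩,
    Iff.trans ⟨fun h => h.congr hJ hθ, fun h => ?_⟩ (hF.isTorsionFlow_iff ha hb hc h0)⟩
  exact h.congr (fun t ht => (hJ t ht).symm) fun t ht => (hθ t ht).symm

end IsContactFrame

end TorsionFlow

end

theorem mainTheorem9 {M : Type*} [TopologicalSpace M] [T2Space M] [SecondCountableTopology M]
    [ChartedSpace TorsionFlow.E3 M] [IsManifold (𝓡 3) ∞ M]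
    (ξ : TorsionFlow.PlaneField M) (J : TorsionFlow.PlaneEndo ξ) (θ : TorsionFlow.OneForm M ℝ)
    (hJθ : TorsionFlow.IsPseudohermitian ξ J θ)
    (hc₁ : TorsionFlow.FirstChernClassEqZero J) :
    ∃ F : TorsionFlow.Frame ξ, TorsionFlow.IsSymplecticFrame θ F ∧
      -- all triples `a, b, c` with `b, c > 0` define pseudohermitian structures, and the
      -- coefficient `A₁₁` is the one of their Tanaka-Webster connection
      (∀ a b c : M → ℝ,
        ContMDiff (𝓡 3) 𝓘(ℝ, ℝ) ∞ a → ContMDiff (𝓡 3) 𝓘(ℝ, ℝ) ∞ b →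
        ContMDiff (𝓡 3) 𝓘(ℝ, ℝ) ∞ c → (∀ x, 0 < b x) → (∀ x, 0 < c x) →
        TorsionFlow.IsPseudohermitian ξ (TorsionFlow.Jabc F θ a b c) (TorsionFlow.thetaB θ b) ∧
        TorsionFlow.SameCoorientation θ (TorsionFlow.thetaB θ b) ∧
        TorsionFlow.IsAdmissibleCoframe ξ (TorsionFlow.Jabc F θ a b c) (TorsionFlow.thetaB θ b)
          univ (TorsionFlow.theta1abc F θ a b c) ∧
        ∃ φ : TorsionFlow.OneForm M ℂ, TorsionFlow.IsTanakaWebster (TorsionFlow.thetaB θ b)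
          univ (TorsionFlow.theta1abc F θ a b c) φ (TorsionFlow.A11abc F θ a b c)) ∧
      -- every cooriented pseudohermitian structure on `ξ` (in particular `J, θ`) is of the
      -- form `J_{abc}, θ_b`
      (∀ (J' : TorsionFlow.PlaneEndo ξ) (θ' : TorsionFlow.OneForm M ℝ),
        TorsionFlow.IsPseudohermitian ξ J' θ' → TorsionFlow.SameCoorientation θ θ' →
        ∃! p : (M → ℝ) × (M → ℝ) × (M → ℝ),
          ContMDiff (𝓡 3) 𝓘(ℝ, ℝ) ∞ p.1 ∧ ContMDiff (𝓡 3) 𝓘(ℝ, ℝ) ∞ p.2.1 ∧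
          ContMDiff (𝓡 3) 𝓘(ℝ, ℝ) ∞ p.2.2 ∧ (∀ x, 0 < p.2.1 x) ∧ (∀ x, 0 < p.2.2 x) ∧
          J' = TorsionFlow.Jabc F θ p.1 p.2.1 p.2.2 ∧ θ' = TorsionFlow.thetaB θ p.2.1) ∧
      -- the torsion flow for a family `(J_t, θ_t)` is equivalent to the system for its
      -- functions `a, b, c`
      (∀ (I : Set ℝ) (Jt : ℝ → TorsionFlow.PlaneEndo ξ) (θt : ℝ → TorsionFlow.OneForm M ℝ),
        I.OrdConnected → I.Nontrivial → TorsionFlow.IsSmoothFamily ξ I Jt θt →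
        (∀ t ∈ I, TorsionFlow.SameCoorientation θ (θt t)) →
        ∃ a b c : ℝ → M → ℝ,
          TorsionFlow.SmoothFunFamily I a ∧ TorsionFlow.SmoothFunFamily I b ∧
          TorsionFlow.SmoothFunFamily I c ∧
          (∀ t ∈ I, ∀ x, 0 < b t x ∧ 0 < c t x) ∧
          (∀ t ∈ I, Jt t = TorsionFlow.Jabc F θ (a t) (b t) (c t) ∧
            θt t = TorsionFlow.thetaB θ (b t)) ∧
          (TorsionFlow.IsTorsionFlow ξ I Jt θt ↔ TorsionFlow.SolvesSystem F θ I a b c)) ∧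
      -- conversely, families of functions `a, b, c` define families `(J_t, θ_t)`, and these
      -- solve the torsion flow if and only if the functions solve the system
      (∀ (I : Set ℝ) (a b c : ℝ → M → ℝ),
        I.OrdConnected → I.Nontrivial →
        TorsionFlow.SmoothFunFamily I a → TorsionFlow.SmoothFunFamily I b →
        TorsionFlow.SmoothFunFamily I c → (∀ t ∈ I, ∀ x, 0 < b t x ∧ 0 < c t x) →
        TorsionFlow.IsSmoothFamily ξ I (fun t => TorsionFlow.Jabc F θ (a t) (b t) (c t))
          (fun t => TorsionFlow.thetaB θ (b t)) ∧
        (TorsionFlow.IsTorsionFlow ξ I (fun t => TorsionFlow.Jabc F θ (a t) (b t) (c t))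
            (fun t => TorsionFlow.thetaB θ (b t)) ↔
          TorsionFlow.SolvesSystem F θ I a b c)) := by
  -- Together with second countability this yields the σ-compactness needed for partitions of unity.
  have : LocallyCompactSpace M := ChartedSpace.locallyCompactSpace TorsionFlow.E3 M
  obtain ⟨S, hS, hS0⟩ := TorsionFlow.exists_global_section hJθ hc₁
  obtain ⟨F, hF⟩ := TorsionFlow.exists_isContactFrame hJθ hS hS0
  refine ⟨F, hF.toIsSymplecticFrame, fun a b c ha hb hc hb0 hc0 => ?_, fun J' θ' hJ' hco => ?_,
    fun I Jt θt _ _ hfam hco => hF.exists_functions hfam hco,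
    fun I a b c _ _ ha hb hc h0 => ⟨hF.isSmoothFamily ha hb hc h0,
      hF.isTorsionFlow_iff ha hb hc h0⟩⟩
  · have hFb := hF.deform hb hb0
    exact ⟨hFb.isPseudohermitian ha hc hc0, TorsionFlow.sameCoorientation_thetaB hb0,
      hFb.isAdmissibleCoframe ha hc hc0, hFb.exists_isTanakaWebster_torsionCoeff ha hc hc0⟩
  · exact hF.existsUnique_functions hJ' hco
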